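/- **Notation.** Let $\widehat f(\omega)=\int_{\mathbb R^d} f(x)e^{-2\pi i x\cdot\omega}\,dx$, $\langle x\rangle=(1+|x|^2)^{1/2}$ and $w_{t,s}(x,\omega)=\langle x\rangle^t\langle\omega\rangle^s$ for $x,\omega\in\mathbb R^d$, $t,s\in\mathbb R$. For $1\le p,q\le\infty$, $L^{p,q}_{t,s}(\mathbb R^{2d})$ is the space of measurable $F$ (modulo equality a.e.) with $$\|F\|_{L^{p,q}_{t,s}}=\Big(\int_{\mathbb R^d}\Big(\int_{\mathbb R^d}|F(x,\omega)\,w_{t,s}(x,\omega)|^p\,dx\Big)^{q/p}d\omega\Big)^{1/q}<\infty$$ (essential suprema if an exponent is $\infty$), and $L^{p,q}=L^{p,q}_{0,0}$. $\mathcal S^{(1)}(\mathbb R^n)$ is the space of smooth $\varphi$ with $\varphi e^{h|\cdot|}$ and $\widehat\varphi e^{h|\cdot|}$ bounded for every $h>0$; fix a window $\varphi\in\mathcal S^{(1)}(\mathbb R^n)\setminus\{0\}$ and let $V_\varphi f(x,\omega)=\int_{\mathbb R^n} f(t)\overline{\varphi(t-x)}e^{-2\pi i\omega\cdot t}\,dt$.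 $S_0(\mathbb R^n)$ is the set of $f\in L^2(\mathbb R^n)$ with $V_\varphi f\in L^1(\mathbb R^{2n})$. For a weight $w$ on $\mathbb R^{2n}$, $M^1_w(\mathbb R^n)$ is the set of $f\in(\mathcal S^{(1)})'(\mathbb R^n)$ with $V_\varphi f\cdot w\in L^1(\mathbb R^{2n})$. (None of these spaces depends on the choice of $\varphi$.) Write $M^1_{0,\sigma}(\mathbb R^d)=M^1_{w_{0,\sigma}}(\mathbb R^d)$. On phase space, $M^1_{t,s}(\mathbb R^{2d})$ denotes $M^1_w(\mathbb R^{2d})$ for the weight $w((x,\omega),\zeta)=w_{t,s}(x,\omega)$, $(x,\omega)\in\mathbb R^{2d}$, $\zeta\in\mathbb R^{2d}$ (no weight in the dual variable $\zeta$). The Gabor product is $$(F\natural_g H)(x,\omega)=\int_{\mathbb R^{3d}}\overline{\widehat g(\omega'+\omega''-\omega)}\,F(x',\omega')\,H(x',\omega'')\,e^{2\pi i x\cdot(\omega'+\omega''-\omega)}\,dx'\,d\omega'\,d\omega''.$$ **Theorem.** Let $1\le p,q_0,q_1,q_2\le\infty$ with $R(q):=1+\frac1{q_0}-\frac1{q_1}-\frac1{q_2}=0$,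 let $\frac1p+\frac1{p'}=1$, $\frac1{q_0}+\frac1{q_0'}=1$, and let $\max\{q_0,q_0'\}\le r\le\infty$. 1. If $g\in S_0(\mathbb R^d)\setminus\{0\}$, then $S_0(\mathbb R^{2d})\subset L^{p,q_1}(\mathbb R^{2d})\cap L^{p',q_2}(\mathbb R^{2d})$ and the Gabor product $\natural_g$ extends from $S_0(\mathbb R^{2d})\times S_0(\mathbb R^{2d})$ to a continuous bilinear map from $L^{p,q_1}(\mathbb R^{2d})\times L^{p',q_2}(\mathbb R^{2d})$ to $L^{r,q_0}(\mathbb R^{2d})$, and there is a constant $C$, independent of $F$ and $H$, with $$\|F\natural_g H\|_{L^{r,q_0}}\le C\,\|F\|_{L^{p,q_1}}\,\|H\|_{L^{p',q_2}}.$$ 2. If $t_1,t_2,s_1,s_2,s\in\mathbb R$ satisfy $t_1+t_2\ge0$, $s_1+s_2\ge0$, $\min\{s_1,s_2\}\ge s$, and if $g\in M^1_{0,|s|}(\mathbb R^d)\setminus\{0\}$, then $M^1_{t_1,s_1}(\mathbb R^{2d})\subset L^{p,q_1}_{t_1,s_1}(\mathbb R^{2d})$, $M^1_{t_2,s_2}(\mathbb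 R^{2d})\subset L^{p',q_2}_{t_2,s_2}(\mathbb R^{2d})$, and $\natural_g$ extends from $M^1_{t_1,s_1}(\mathbb R^{2d})\times M^1_{t_2,s_2}(\mathbb R^{2d})$ to a continuous bilinear map from $L^{p,q_1}_{t_1,s_1}(\mathbb R^{2d})\times L^{p',q_2}_{t_2,s_2}(\mathbb R^{2d})$ to $L^{r,q_0}_{0,s}(\mathbb R^{2d})$, and there is a constant $C$, independent of $F$ and $H$, with $$\|F\natural_g H\|_{L^{r,q_0}_{0,s}}\le C\,\|F\|_{L^{p,q_1}_{t_1,s_1}}\,\|H\|_{L^{p',q_2}_{t_2,s_2}}.$$ In both parts the extension is given by the same integral, which converges absolutely for all $(x,\omega)\in\mathbb R^{2d}$ and all $F$, $H$ in the respective spaces. -/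

import Mathlib

open MeasureTheory
open scoped ENNReal FourierTransform ComplexConjugate

noncomputable section

namespace GaborProduct

/-- Configuration space `ℝ^d`, with its Euclidean norm and Lebesgue measure. -/
abbrev Conf (d : ℕ) : Type := EuclideanSpace ℝ (Fin d)

/-- Phase space `ℝ^{2d} = ℝ^d_x × ℝ^d_ω`; its measure is the product of the Lebesgue measures. -/
abbrev Phase (d : ℕ) : Type := Conf d × Conf d

/-- Phase space as a Euclidean space (the same set, with the Euclidean norm and inner product of
`ℝ^{2d}`); used where Fourier analysis on `ℝ^{2d}` is needed. -/
abbrev EPhase (d : ℕ) : Type := WithLp 2 (Phase d)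

/-- A function on phase space, read as a function on Euclidean `ℝ^{2d}`. -/
def onEPhase {d : ℕ} (F : Phase d → ℂ) : EPhase d → ℂ := fun Z => F (WithLp.ofLp Z)

/-- The Japanese bracket `⟨x⟩ = (1 + |x|^2)^{1/2}`, raised to the real power `t`. -/
def bracketPow {V : Type*} [NormedAddCommGroup V] (t : ℝ) (x : V) : ℝ :=
  (1 + ‖x‖ ^ 2) ^ (t / 2)

/-- The weight `w_{t,s}(x, ω) = ⟨x⟩^t ⟨ω⟩^s`. -/
def polyWeight {V : Type*} [NormedAddCommGroup V] (t s : ℝ) (x ω : V) : ℝ :=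
  bracketPow t x * bracketPow s ω

/-- The Young functional `R(q) = 1 + 1/q₀ - 1/q₁ - 1/q₂` for exponents in `[1, ∞]`, `1/∞ = 0`. -/
def youngR (q₀ q₁ q₂ : ℝ≥0∞) : ℝ :=
  1 + (q₀⁻¹).toReal - (q₁⁻¹).toReal - (q₂⁻¹).toReal

section TimeFrequency

variable {V : Type*} [NormedAddCommGroup V] [InnerProductSpace ℝ V] [FiniteDimensional ℝ V]
  [MeasurableSpace V] [BorelSpace V]

/-- The Gelfand–Shilov space `S^{(1)}`: smooth functions which, together with their Fourier
transform, decay faster than every exponential. -/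
def IsGelfandShilov (φ : V → ℂ) : Prop :=
  ContDiff ℝ (⊤ : ℕ∞) φ ∧ ∀ h : ℝ, 0 < h →
    (∃ C : ℝ, ∀ x, ‖φ x‖ * Real.exp (h * ‖x‖) ≤ C) ∧
    (∃ C : ℝ, ∀ ω, ‖𝓕 φ ω‖ * Real.exp (h * ‖ω‖) ≤ C)

/-- The short-time Fourier transform
`V_φ f (x, ω) = ∫ f(t) conj(φ(t - x)) e^{-2πi ω·t} dt`. -/
def stft (φ f : V → ℂ) (x ω : V) : ℂ :=
  ∫ t, f t * conj (φ (t - x)) * Complex.exp (-(2 * Real.pi * inner ℝ ω t : ℝ) * Complex.I)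

/-- The Feichtinger algebra `S₀`: the `f ∈ L²` with `V_φ f ∈ L¹` for a window
`φ ∈ S^{(1)} \ {0}` (the choice of the window does not matter). -/
def IsFeichtinger (f : V → ℂ) : Prop :=
  MemLp f 2 ∧ ∃ φ : V → ℂ, IsGelfandShilov φ ∧ φ ≠ 0 ∧
    Integrable (fun z : V × V => stft φ f z.1 z.2)

/-- The functions in the weighted modulation space `M^1_w`, for a weight `w` on `V × V`:
measurable `f` that define an ultradistribution by integration against `S^{(1)}`, with
`V_φ f · w ∈ L¹` for a window `φ ∈ S^{(1)} \ {0}`. For the weights used below (`w(x, ω)` bounded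
below by a power of `⟨x⟩`) every ultradistribution in `M^1_w` is such a function. -/
def MemModulationOne (w : V → V → ℝ) (f : V → ℂ) : Prop :=
  AEStronglyMeasurable f ∧ (∀ φ : V → ℂ, IsGelfandShilov φ → Integrable (fun x => f x * φ x)) ∧
    ∃ φ : V → ℂ, IsGelfandShilov φ ∧ φ ≠ 0 ∧
      Integrable (fun z : V × V => (w z.1 z.2 : ℂ) * stft φ f z.1 z.2)

end TimeFrequency

section Product

variable {d : ℕ}

/-- The integrand of the Gabor product at `(x, ω)`, as a function of `(x', ω', ω'')`. -/
def gaborIntegrand (g : Conf d → ℂ) (F H : Phase d → ℂ) (x ω : Conf d)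
    (y : Conf d × Conf d × Conf d) : ℂ :=
  conj (𝓕 g (y.2.1 + y.2.2 - ω)) * F (y.1, y.2.1) * H (y.1, y.2.2) *
    Complex.exp ((2 * Real.pi * inner ℝ x (y.2.1 + y.2.2 - ω) : ℝ) * Complex.I)

/-- The Gabor product
`(F ♮_g H)(x, ω) = ∫_{ℝ^{3d}} conj(ĝ(ω' + ω'' - ω)) F(x', ω') H(x', ω'')
  e^{2πi x·(ω' + ω'' - ω)} dx' dω' dω''`. -/
def gaborProduct (g : Conf d → ℂ) (F H : Phase d → ℂ) (z : Phase d) : ℂ :=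
  ∫ y, gaborIntegrand g F H z.1 z.2 y

end Product

section MixedNorm

variable {d : ℕ}

/-- The weighted mixed norm
`‖F‖_{L^{p,q}_{t,s}} = ‖ ω ↦ ‖ w_{t,s}(·, ω) F(·, ω) ‖_{L^p(dx)} ‖_{L^q(dω)}` in `[0, ∞]`. -/
def eMixedNorm (p q : ℝ≥0∞) (t s : ℝ) (F : Phase d → ℂ) : ℝ≥0∞ :=
  eLpNorm (fun ω : Conf d => eLpNorm (fun x : Conf d => (polyWeight t s x ω : ℂ) * F (x, ω)) p) q

theorem bracketPow_pos {V : Type*} [NormedAddCommGroup V] (t : ℝ) (x : V) : 0 < bracketPow t x :=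
  Real.rpow_pos_of_pos (by positivity) _

theorem continuous_bracketPow {V : Type*} [NormedAddCommGroup V] (t : ℝ) :
    Continuous (bracketPow t : V → ℝ) := by
  unfold bracketPow
  refine Continuous.rpow_const (by fun_prop) fun x => Or.inl ?_
  positivity

theorem continuous_polyWeight (t s : ℝ) :
    Continuous (fun z : Phase d => (polyWeight t s z.1 z.2 : ℂ)) := by
  unfold polyWeight
  exact Complex.continuous_ofReal.comp
    (((continuous_bracketPow t).comp continuous_fst).mul
      ((continuous_bracketPow s).comp continuous_snd))

theorem polyWeight_ne_zero (t s : ℝ) (x ω : Conf d) : (polyWeight t s x ω : ℂ) ≠ 0 :=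
  Complex.ofReal_ne_zero.2 (mul_pos (bracketPow_pos t x) (bracketPow_pos s ω)).ne'

theorem ae_ae_swap {P : Phase d → Prop} (h : ∀ᵐ z : Phase d, P z) :
    ∀ᵐ ω : Conf d, ∀ᵐ x : Conf d, P (x, ω) := by
  have h2 := (Measure.measurePreserving_swap (μ := (volume : Measure (Conf d)))
    (ν := (volume : Measure (Conf d)))).quasiMeasurePreserving.ae h
  exact Measure.ae_ae_of_ae_prod h2

theorem eMixedNorm_congr {p q : ℝ≥0∞} {t s : ℝ} {F G : Phase d → ℂ} (h : F =ᵐ[volume] G) :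
    eMixedNorm p q t s F = eMixedNorm p q t s G := by
  refine eLpNorm_congr_ae ?_
  filter_upwards [ae_ae_swap h] with ω hω
  refine eLpNorm_congr_ae ?_
  filter_upwards [hω] with x hx
  rw [hx]

theorem measurable_inner_eLpNorm {K : Phase d → ℂ} (hK : Measurable K) (p : ℝ≥0∞) :
    Measurable (fun ω : Conf d => eLpNorm (fun x : Conf d => K (x, ω)) p) := by
  by_cases h0 : p = 0
  · simp [h0]
  by_cases ht : p = ∞
  · subst ht
    simp only [eLpNorm_exponent_top]
    refine measurable_of_Iic fun c => ?_
    have hset : (fun ω : Conf d => eLpNormEssSup (fun x : Conf d => K (x, ω)) volume) ⁻¹'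
        Set.Iic c = {ω | volume ((fun x : Conf d => (x, ω)) ⁻¹' {z | c < ‖K z‖ₑ}) = 0} := by
      ext ω
      simp only [Set.mem_preimage, Set.mem_Iic, Set.mem_ofPred_eq]
      constructor
      · intro h
        have : ∀ᵐ x : Conf d, ‖K (x, ω)‖ₑ ≤ c := by
          filter_upwards [enorm_ae_le_eLpNormEssSup (fun x : Conf d => K (x, ω)) volume] with x hx
          exact hx.trans h
        rw [ae_iff] at this
        simpa [not_le] using this
      · intro h
        refine essSup_le_of_ae_le c ?_
        rw [Filter.EventuallyLE, ae_iff]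
        simpa [not_le] using h
    rw [hset]
    have hm : MeasurableSet {z : Phase d | c < ‖K z‖ₑ} :=
      measurableSet_lt measurable_const hK.enorm
    exact (measurable_measure_prodMk_right hm) (measurableSet_singleton 0)
  · simp only [eLpNorm_eq_lintegral_rpow_enorm_toReal h0 ht]
    refine Measurable.pow_const ?_ _
    exact Measurable.lintegral_prod_left' (f := fun z : Phase d => ‖K z‖ₑ ^ p.toReal)
      (hK.enorm.pow_const _)

theorem measurable_slice {K : Phase d → ℂ} (hK : Measurable K) (ω : Conf d) :
    Measurable fun x : Conf d => K (x, ω) :=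
  hK.comp measurable_prodMk_right

theorem measurable_weighted {F : Phase d → ℂ} (hF : Measurable F) (t s : ℝ) :
    Measurable (fun z : Phase d => (polyWeight t s z.1 z.2 : ℂ) * F z) :=
  (continuous_polyWeight t s).measurable.mul hF

theorem eMixedNorm_add_le {p q : ℝ≥0∞} (hp : 1 ≤ p) (hq : 1 ≤ q) {t s : ℝ} {F G : Phase d → ℂ}
    (hF : AEStronglyMeasurable F) (hG : AEStronglyMeasurable G) :
    eMixedNorm p q t s (F + G) ≤ eMixedNorm p q t s F + eMixedNorm p q t s G := by
  have hF' := hF.ae_eq_mk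
  have hG' := hG.ae_eq_mk
  rw [eMixedNorm_congr hF', eMixedNorm_congr hG', eMixedNorm_congr (hF'.add hG')]
  have mF := measurable_weighted hF.stronglyMeasurable_mk.measurable t s
  have mG := measurable_weighted hG.stronglyMeasurable_mk.measurable t s
  generalize hF.mk F = F' at *
  generalize hG.mk G = G' at *
  unfold eMixedNorm
  refine le_trans (eLpNorm_mono_enorm fun ω => ?_)
    (eLpNorm_add_le (measurable_inner_eLpNorm mF p).aestronglyMeasurable
      (measurable_inner_eLpNorm mG p).aestronglyMeasurable hq)
  simp only [enorm_eq_self, Pi.add_apply, mul_add]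
  exact eLpNorm_add_le (measurable_slice mF ω).aestronglyMeasurable
    (measurable_slice mG ω).aestronglyMeasurable hp

theorem eLpNorm_const_mul_ennreal {c : ℝ≥0∞} (hc : c ≠ ∞) (k : Conf d → ℝ≥0∞) (q : ℝ≥0∞) :
    eLpNorm (fun ω => c * k ω) q volume = c * eLpNorm k q volume := by
  by_cases h0 : q = 0
  · simp [h0]
  by_cases ht : q = ∞
  · subst ht
    simp only [eLpNorm_exponent_top, eLpNormEssSup, enorm_eq_self]
    exact ENNReal.essSup_const_mul
  · have hpos := ENNReal.toReal_pos h0 ht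
    simp only [eLpNorm_eq_lintegral_rpow_enorm_toReal h0 ht, enorm_eq_self,
      ENNReal.mul_rpow_of_nonneg _ _ hpos.le]
    rw [lintegral_const_mul' _ _ (ENNReal.rpow_ne_top_of_nonneg hpos.le hc),
      ENNReal.mul_rpow_of_nonneg _ _ (by positivity), ← ENNReal.rpow_mul,
      mul_one_div_cancel hpos.ne', ENNReal.rpow_one]

theorem eMixedNorm_const_smul (p q : ℝ≥0∞) (t s : ℝ) (c : ℂ) (F : Phase d → ℂ) :
    eMixedNorm p q t s (c • F) = ‖c‖ₑ * eMixedNorm p q t s F := by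
  unfold eMixedNorm
  have h1 : ∀ ω : Conf d, eLpNorm (fun x : Conf d => (polyWeight t s x ω : ℂ) * (c • F) (x, ω)) p
      = ‖c‖ₑ * eLpNorm (fun x : Conf d => (polyWeight t s x ω : ℂ) * F (x, ω)) p := by
    intro ω
    rw [← eLpNorm_const_smul]
    congr 1
    ext x
    simp only [Pi.smul_apply, smul_eq_mul]
    ring
  simp only [h1]
  exact eLpNorm_const_mul_ennreal enorm_ne_top _ q

theorem eMixedNorm_zero (p q : ℝ≥0∞) (t s : ℝ) :
    eMixedNorm p q t s (0 : Phase d → ℂ) = 0 := by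
  have := eMixedNorm_const_smul p q t s 0 (0 : Phase d → ℂ)
  simpa using this

theorem ae_eq_zero_of_eMixedNorm {p q : ℝ≥0∞} (hp : 1 ≤ p) (hq : 1 ≤ q) {t s : ℝ}
    {F : Phase d → ℂ} (hF : AEStronglyMeasurable F) (h : eMixedNorm p q t s F = 0) :
    F =ᵐ[volume] 0 := by
  refine hF.ae_eq_mk.trans ?_
  rw [eMixedNorm_congr hF.ae_eq_mk] at h
  have m0 := hF.stronglyMeasurable_mk.measurable
  have mF := measurable_weighted m0 t s
  generalize hF.mk F = F' at *
  unfold eMixedNorm at h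
  rw [eLpNorm_eq_zero_iff (measurable_inner_eLpNorm mF p).aestronglyMeasurable
    (zero_lt_one.trans_le hq).ne'] at h
  have h2 : ∀ᵐ ω : Conf d, ∀ᵐ x : Conf d, F' (x, ω) = 0 := by
    filter_upwards [h] with ω hω
    have mω : Measurable fun x : Conf d => (polyWeight t s x ω : ℂ) * F' (x, ω) :=
      measurable_slice mF ω
    have hω' := (eLpNorm_eq_zero_iff mω.aestronglyMeasurable
      (zero_lt_one.trans_le hp).ne').1 hω
    filter_upwards [hω'] with x hx
    exact (mul_eq_zero.1 hx).resolve_left (polyWeight_ne_zero t s x ω)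
  have hset : MeasurableSet {z : Phase d | F' z = 0} := m0 (measurableSet_singleton 0)
  have h3 : ∀ᵐ x : Conf d, ∀ᵐ ω : Conf d, F' (x, ω) = 0 :=
    (Measure.ae_ae_comm (p := fun x ω : Conf d => F' (x, ω) = 0) hset).2 h2
  have h4 : ∀ᵐ z : Phase d, F' z = 0 := (Measure.ae_prod_iff_ae_ae hset).2 h3
  filter_upwards [h4] with z hz
  exact hz

/-- Membership in `L^{p,q}_{t,s}(ℝ^{2d})`: measurable, with finite weighted mixed norm. -/
def MemMixed (p q : ℝ≥0∞) (t s : ℝ) (F : Phase d → ℂ) : Prop :=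
  AEStronglyMeasurable F ∧ eMixedNorm p q t s F < ∞

/-- The space `L^{p,q}_{t,s}(ℝ^{2d})` of classes of functions modulo equality almost everywhere. -/
def MixedLp (d : ℕ) (p q : ℝ≥0∞) [hp : Fact (1 ≤ p)] [hq : Fact (1 ≤ q)] (t s : ℝ) :
    Submodule ℂ (Phase d →ₘ[volume] ℂ) where
  carrier := {F | eMixedNorm p q t s F < ∞}
  zero_mem' := by
    rw [Set.mem_ofPred_eq, eMixedNorm_congr AEEqFun.coeFn_zero, eMixedNorm_zero]
    exact ENNReal.zero_lt_top
  add_mem' := by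
    intro F G hF hG
    rw [Set.mem_ofPred_eq, eMixedNorm_congr (AEEqFun.coeFn_add F G)]
    exact (eMixedNorm_add_le hp.out hq.out F.aestronglyMeasurable G.aestronglyMeasurable).trans_lt
      (ENNReal.add_lt_top.2 ⟨hF, hG⟩)
  smul_mem' := by
    intro c F hF
    rw [Set.mem_ofPred_eq, eMixedNorm_congr (AEEqFun.coeFn_smul c F), eMixedNorm_const_smul]
    exact ENNReal.mul_lt_top enorm_lt_top hF

variable {p q : ℝ≥0∞} [hp : Fact (1 ≤ p)] [hq : Fact (1 ≤ q)] {t s : ℝ}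

/-- The norm of `L^{p,q}_{t,s}`. -/
def mixedNorm : AddGroupNorm (MixedLp d p q t s) where
  toFun F := (eMixedNorm p q t s (F : Phase d →ₘ[volume] ℂ)).toReal
  map_zero' := by
    rw [Submodule.coe_zero, eMixedNorm_congr AEEqFun.coeFn_zero, eMixedNorm_zero]
    rfl
  add_le' F G := by
    rw [Submodule.coe_add, eMixedNorm_congr (AEEqFun.coeFn_add F.1 G.1),
      ← ENNReal.toReal_add F.2.ne G.2.ne]
    exact ENNReal.toReal_mono (ENNReal.add_lt_top.2 ⟨F.2, G.2⟩).ne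
      (eMixedNorm_add_le hp.out hq.out F.1.aestronglyMeasurable G.1.aestronglyMeasurable)
  neg' F := by
    have h : eMixedNorm p q t s (-(F.1) : Phase d →ₘ[volume] ℂ) = eMixedNorm p q t s F.1 := by
      rw [← neg_one_smul ℂ F.1, eMixedNorm_congr (AEEqFun.coeFn_smul (-1 : ℂ) F.1),
        eMixedNorm_const_smul]
      simp
    rw [Submodule.coe_neg, h]
  eq_zero_of_map_eq_zero' F h := by
    have h0 : eMixedNorm p q t s F.1 = 0 :=
      ((ENNReal.toReal_eq_zero_iff _).1 h).resolve_right F.2.ne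
    refine Subtype.ext (AEEqFun.ext ?_)
    exact (ae_eq_zero_of_eMixedNorm hp.out hq.out F.1.aestronglyMeasurable h0).trans
      AEEqFun.coeFn_zero.symm

instance : NormedAddCommGroup (MixedLp d p q t s) := mixedNorm.toNormedAddCommGroup

theorem norm_mixedLp (F : MixedLp d p q t s) : ‖F‖ = (eMixedNorm p q t s F.1).toReal := rfl

instance : NormedSpace ℂ (MixedLp d p q t s) where
  norm_smul_le c F := by
    rw [norm_mixedLp, norm_mixedLp, Submodule.coe_smul,
      eMixedNorm_congr (AEEqFun.coeFn_smul c F.1), eMixedNorm_const_smul, ENNReal.toReal_mul]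
    simp

/-- The class in `L^{p,q}_{t,s}` of a function with finite norm. -/
def MemMixed.toMixedLp {F : Phase d → ℂ} (hF : MemMixed p q t s F) : MixedLp d p q t s :=
  ⟨AEEqFun.mk F hF.1, by
    change eMixedNorm p q t s (AEEqFun.mk F hF.1) < ∞
    rw [eMixedNorm_congr (AEEqFun.coeFn_mk F hF.1)]
    exact hF.2⟩

end MixedNorm

/-- `S₀(ℝ^{2d})`, for functions on phase space. -/
def IsFeichtingerPhase {d : ℕ} (F : Phase d → ℂ) : Prop := IsFeichtinger (onEPhase F)

/-- `M^1_{t,s}(ℝ^{2d})`, for functions on phase space: the weight `w_{t,s}(x, ω)` is taken at the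
phase space point `(x, ω)`, and there is no weight in the `2d` dual variables. -/
def MemModulationOnePhase {d : ℕ} (t s : ℝ) (F : Phase d → ℂ) : Prop :=
  MemModulationOne (fun Z _ : EPhase d => polyWeight t s (WithLp.ofLp Z).1 (WithLp.ofLp Z).2)
    (onEPhase F)

end GaborProduct

end

open GaborProduct

noncomputable section

namespace GaborProduct

/-! Substitute `ζ = ω' + ω'' - ω`. For fixed `ω` the Gabor product becomes an inverse Fourier
transform in `ζ`, evaluated at `x`, of `conj (ĝ ζ) * Φ (ζ + ω)`, where `Φ η = ∫∫ F(x', ω') H(x', η -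
ω') dx' dω'`. Four classical inequalities then give the estimate. Hölder in `x'` bounds `|Φ|` by a
convolution `k = f * h` of slice norms, and Young puts `k` in `L^{q₀}`, since `R(q) = 0` is Young's
relation. Hausdorff–Young in `ζ` bounds the `L^r` norm in `x` by the `L^{r'}` norm of `γ(ζ) k(ζ +
ω)`, with `γ` the weighted `|ĝ|`. Minkowski in `ω` gives `‖γ‖_{r'} ‖k‖_{q₀}`. The condition `r ≥ max
q₀ q₀'` yields exactly what is used: `r ≥ 2` for Hausdorff–Young and `r' ≤ q₀` for Minkowski.
Absolute convergence at every point is Hölder with `γ ∈ L^{q₀'}` and `k ∈ L^{q₀}`.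

The weights enter through Peetre's inequality, which distributes `⟨ω⟩^s` over `ζ`, `ω'` and `ω''`
(`exists_bracketPow_le_mul_mul`). The window condition places `γ` in every `L^e`, `e ≥ 1`
(`MemModulationOne.fourier_weighted`).

The inclusions of the modulation spaces in the mixed-norm spaces rest on Fourier inversion of the
STFT in its frequency variable: `|f|` is dominated by the convolution of the frequency integral of
`|V_φ f|` with `|φ|` (`exists_enorm_le_lintegral_stft`), and `φ` decays fast enough to absorb
polynomial weights.

Hausdorff–Young with a non-sharp constant suffices; it is obtained by real interpolation between the
`L¹ → L^∞` bound and Plancherel. The unweighted part of the theorem is the weighted part with all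
exponents zero. -/

/-- Pointwise `|f|^p ≤ ‖f‖_∞^(p-1) |f|`; both factors are then bounded by the sum `N`. This reduces
later memberships in all `L^p` to the two endpoints. -/
theorem eLpNorm_le_eLpNorm_one_add_eLpNorm_top {α ε : Type*} [MeasurableSpace α] {μ : Measure α}
    [TopologicalSpace ε] [ContinuousENorm ε] (f : α → ε) {p : ℝ≥0∞} (hp : 1 ≤ p) :
    eLpNorm f p μ ≤ eLpNorm f 1 μ + eLpNorm f ∞ μ := by
  rcases eq_or_ne p ∞ with rfl | hptop
  · exact le_add_self
  have hp0 : p ≠ 0 := (zero_lt_one.trans_le hp).ne'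
  have hp1 : 1 ≤ p.toReal := by simpa using ENNReal.toReal_mono hptop hp
  set N := eLpNorm f 1 μ + eLpNorm f ∞ μ with hN
  have h1 : ∫⁻ x, ‖f x‖ₑ ^ p.toReal ∂μ ≤ N ^ p.toReal := by
    calc ∫⁻ x, ‖f x‖ₑ ^ p.toReal ∂μ
        ≤ ∫⁻ x, eLpNorm f ∞ μ ^ (p.toReal - 1) * ‖f x‖ₑ ∂μ := by
          refine lintegral_mono_ae ?_
          filter_upwards [enorm_ae_le_eLpNormEssSup f μ] with x hx
          rw [show p.toReal = (p.toReal - 1) + 1 by ring,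
            ENNReal.rpow_add_of_nonneg _ _ (by linarith) zero_le_one, ENNReal.rpow_one]
          simp only [add_sub_cancel_right]
          gcongr
          simpa using hx
      _ ≤ ∫⁻ x, N ^ (p.toReal - 1) * ‖f x‖ₑ ∂μ := by
          gcongr
          exact le_add_self
      _ ≤ N ^ (p.toReal - 1) * N := by
          rcases eq_or_ne N ∞ with h | h
          · rcases hp1.eq_or_lt with h' | h'
            · rw [← h', sub_self, ENNReal.rpow_zero]
              simp [h]
            · rw [h, ENNReal.top_rpow_of_pos (by linarith)]
              simp
          · rw [lintegral_const_mul' _ _ (ENNReal.rpow_ne_top_of_nonneg (by linarith) h)]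
            gcongr
            rw [← eLpNorm_one_eq_lintegral_enorm]
            exact le_self_add
      _ = N ^ p.toReal := by
          conv_rhs => rw [show p.toReal = (p.toReal - 1) + 1 by ring,
            ENNReal.rpow_add_of_nonneg _ _ (by linarith) zero_le_one, ENNReal.rpow_one]
  rw [eLpNorm_eq_lintegral_rpow_enorm_toReal hp0 hptop]
  calc _ ≤ (N ^ p.toReal) ^ (1 / p.toReal) := by gcongr
    _ = N := by rw [← ENNReal.rpow_mul, mul_one_div_cancel (by linarith), ENNReal.rpow_one]

/-! ### Plancherel, Fourier inversion and Hausdorff–Young -/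

section Fourier

variable {V : Type*} [NormedAddCommGroup V] [InnerProductSpace ℝ V] [FiniteDimensional ℝ V]
  [MeasurableSpace V] [BorelSpace V]

theorem integral_fourier_mul_eq {f g : V → ℂ} (hf : Integrable f) (hg : Integrable g) :
    ∫ ξ, 𝓕 f ξ * g ξ = ∫ x, f x * 𝓕 g x := by
  simpa using! VectorFourier.integral_bilin_fourierIntegral_eq_flip (.mul ℂ ℂ) (L := innerₗ V)
    Real.continuous_fourierChar continuous_inner hf hg

theorem continuous_fourier {f : V → ℂ} (hf : Integrable f) : Continuous (𝓕 f) :=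
  VectorFourier.fourierIntegral_continuous Real.continuous_fourierChar
    (L := innerₗ V) continuous_inner hf

theorem enorm_fourier_le (f : V → ℂ) (ξ : V) : ‖𝓕 f ξ‖ₑ ≤ ∫⁻ x, ‖f x‖ₑ := by
  rw [Real.fourier_eq]
  refine (enorm_integral_le_lintegral_enorm _).trans_eq ?_
  refine lintegral_congr fun x => ?_
  rw [← ofReal_norm, ← ofReal_norm, Circle.norm_smul]

theorem ae_eq_of_integral_schwartz {f g : V → ℂ} (hf : LocallyIntegrable f)
    (hg : LocallyIntegrable g)
    (h : ∀ ψ : SchwartzMap V ℂ, ∫ x, ψ x * f x = ∫ x, ψ x * g x) : f =ᵐ[volume] g := by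
  refine ae_eq_of_integral_contDiff_smul_eq hf hg fun k hk hk' => ?_
  have h1 : HasCompactSupport (fun x => (k x : ℂ)) := hk'.comp_left (g := fun y : ℝ => (y : ℂ))
      (by simp)
  have h2 : ContDiff ℝ (⊤ : ℕ∞) (fun x => (k x : ℂ)) := Complex.ofRealCLM.contDiff.comp hk
  simpa using h (h1.toSchwartzMap h2)

/-- Plancherel's theorem for integrable square-integrable functions. -/
theorem lintegral_enorm_fourier_sq {f : V → ℂ} (hf : Integrable f) (hf2 : MemLp f 2) :
    ∫⁻ ξ, ‖𝓕 f ξ‖ₑ ^ 2 = ∫⁻ x, ‖f x‖ₑ ^ 2 := by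
  set U : Lp ℂ 2 (volume : Measure V) := 𝓕 (hf2.toLp f) with hU
  -- The transform defined on `L²` agrees with the integral one, because both have the same pairings
  -- with Schwartz functions.
  have hae : (U : V → ℂ) =ᵐ[volume] 𝓕 f := by
    refine ae_eq_of_integral_schwartz ((Lp.memLp U).locallyIntegrable (by norm_num))
      (continuous_fourier hf).locallyIntegrable fun ψ => ?_
    have h1 := congrArg (fun T => T ψ) (Lp.fourier_toTemperedDistribution_eq (hf2.toLp f))
    simp only [TemperedDistribution.fourier_apply, Lp.toTemperedDistribution_apply] at h1
    have h2 := integral_fourier_mul_eq hf ψ.integrable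
    simp only [smul_eq_mul] at h1
    rw [← hU] at h1
    rw [← h1]
    simp only [mul_comm (ψ _)]
    rw [h2]
    refine integral_congr_ae ?_
    filter_upwards [hf2.coeFn_toLp] with x hx
    rw [hx, mul_comm, SchwartzMap.fourier_coe]
  have e : eLpNorm (𝓕 f) 2 = eLpNorm f 2 := by
    rw [← eLpNorm_congr_ae hae, ← eLpNorm_congr_ae hf2.coeFn_toLp, ← Lp.enorm_def, ← Lp.enorm_def,
      ← ofReal_norm, ← ofReal_norm, hU, Lp.norm_fourier_eq]
  have key : ∀ k : V → ℂ, eLpNorm k 2 ^ 2 = ∫⁻ x, ‖k x‖ₑ ^ 2 := fun k => by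
    rw [eLpNorm_eq_lintegral_rpow_enorm_toReal (by norm_num) (by norm_num), ← ENNReal.rpow_natCast,
      ← ENNReal.rpow_mul]
    simp
  rw [← key, ← key, e]

/-- Pairing with a Schwartz function moves both transforms onto it, where inversion is known. Since
`f` need not be continuous, the equality is only almost everywhere. -/
theorem fourierInv_fourier_ae_eq {f : V → ℂ} (hf : Integrable f) (hf' : Integrable (𝓕 f)) :
    𝓕⁻ (𝓕 f) =ᵐ[volume] f := by
  have hc : Continuous (𝓕⁻ (𝓕 f)) := by
    rw [Real.fourierInv_eq_fourier_comp_neg]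
    exact continuous_fourier hf'.comp_neg
  refine ae_eq_of_integral_schwartz hc.locallyIntegrable hf.locallyIntegrable fun ψ => ?_
  have h1 : ∫ x, 𝓕⁻ (𝓕 f) x * ψ x = ∫ x, 𝓕 f x * 𝓕⁻ ψ x := by
    have := integral_fourier_mul_eq hf' ψ.integrable.comp_neg
    rw [← Real.fourierInv_eq_fourier_comp_neg] at this
    rw [← integral_neg_eq_self]
    simp only [Real.fourierInv_eq_fourier_neg, neg_neg]
    rw [this]
    simp [SchwartzMap.fourierInv_coe, Real.fourierInv_eq_fourier_neg]
  have h2 := integral_fourier_mul_eq hf (𝓕⁻ ψ).integrable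
  simp only [mul_comm (ψ _)]
  rw [h1, h2]
  congr 1
  ext x
  congr 1
  rw [← SchwartzMap.fourier_coe, FourierTransform.fourier_fourierInv_eq]

/-- The integral of a power over the part of `(0, ∞)` where a decreasing power is large. -/
theorem lintegral_Ioi_indicator_rpow_mul_sq {q p a v : ℝ} (hq : 2 < q) (hpq : p.HolderConjugate q)
    (ha : 0 < a) (hv : 0 ≤ v) :
    ∫⁻ t in Set.Ioi (0 : ℝ), (if v ≤ (2 * a / t) ^ (q - 1) then ENNReal.ofReal (v ^ 2) else 0) *
      ENNReal.ofReal (4 * t ^ (q - 3)) ≤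
      ENNReal.ofReal (4 * (2 * a) ^ (q - 2) / (q - 2)) * ENNReal.ofReal (v ^ p) := by
  rcases hv.eq_or_lt with rfl | hv
  · simp
  have hp1 : 1 < p := hpq.lt
  have hpq1 : (p - 1) * (q - 1) = 1 := by linear_combination hpq.mul_eq_add
  set T : ℝ := 2 * a * v ^ (-(p - 1)) with hT
  have hT0 : 0 < T := by positivity
  -- Raising to the power `p - 1` inverts the power `q - 1`, so the integration runs only over `(0,
  -- T]`.
  have hsub : ∀ t : ℝ, 0 < t → v ≤ (2 * a / t) ^ (q - 1) → t ≤ T := by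
    intro t ht h
    have h1 : v ^ (p - 1) ≤ 2 * a / t := by
      calc v ^ (p - 1) ≤ ((2 * a / t) ^ (q - 1)) ^ (p - 1) :=
            Real.rpow_le_rpow hv.le h (by linarith)
        _ = 2 * a / t := by
            rw [← Real.rpow_mul (by positivity), mul_comm (q - 1), hpq1, Real.rpow_one]
    rw [le_div_iff₀ ht] at h1
    rw [hT, Real.rpow_neg hv.le, ← div_eq_mul_inv, le_div_iff₀ (by positivity)]
    linarith
  have hInt : ∫⁻ t in Set.Ioc (0 : ℝ) T, ENNReal.ofReal (4 * t ^ (q - 3)) =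
      ENNReal.ofReal (4 * (T ^ (q - 2) / (q - 2))) := by
    -- Here `q > 2` is essential: it makes `q - 3 > -1`.
    have hi : IntervalIntegrable (fun t : ℝ => 4 * t ^ (q - 3)) volume 0 T :=
      (intervalIntegral.intervalIntegrable_rpow' (by linarith)).const_mul 4
    rw [← ofReal_integral_eq_lintegral_ofReal ((intervalIntegrable_iff_integrableOn_Ioc_of_le
      hT0.le).1 hi), ← intervalIntegral.integral_of_le hT0.le, intervalIntegral.integral_const_mul,
      integral_rpow (Or.inl (by linarith))]
    · rw [show q - 3 + 1 = q - 2 by ring, Real.zero_rpow (by linarith), sub_zero]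
    · filter_upwards [ae_restrict_mem measurableSet_Ioc] with t ht
      have := ht.1
      simp only [Pi.zero_apply]
      positivity
  calc _ ≤ ∫⁻ t in Set.Ioi (0 : ℝ), (Set.Ioc (0 : ℝ) T).indicator
        (fun t => ENNReal.ofReal (v ^ 2) * ENNReal.ofReal (4 * t ^ (q - 3))) t := by
        refine setLIntegral_mono' measurableSet_Ioi fun t ht => ?_
        split_ifs with h
        · rw [Set.indicator_of_mem (Set.mem_Ioc.2 ⟨ht, hsub t ht h⟩)]
        · simp
    _ ≤ ∫⁻ t, (Set.Ioc (0 : ℝ) T).indicator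
        (fun t => ENNReal.ofReal (v ^ 2) * ENNReal.ofReal (4 * t ^ (q - 3))) t :=
        setLIntegral_le_lintegral _ _
    _ = ENNReal.ofReal (v ^ 2) * ENNReal.ofReal (4 * (T ^ (q - 2) / (q - 2))) := by
        rw [lintegral_indicator measurableSet_Ioc, lintegral_const_mul' _ _ ENNReal.ofReal_ne_top,
          hInt]
    _ = ENNReal.ofReal (4 * (2 * a) ^ (q - 2) / (q - 2)) * ENNReal.ofReal (v ^ p) := by
        have h2 : 0 < q - 2 := by linarith
        rw [← ENNReal.ofReal_mul (by positivity), ← ENNReal.ofReal_mul (by positivity)]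
        congr 1
        have h3 : v ^ 2 * T ^ (q - 2) = (2 * a) ^ (q - 2) * v ^ p := by
          rw [hT, Real.mul_rpow (by positivity) (by positivity), ← Real.rpow_mul hv.le,
            ← Real.rpow_natCast v 2, mul_left_comm, ← Real.rpow_add hv]
          congr 2
          push_cast
          linear_combination -hpq1
        calc _ = 4 / (q - 2) * (v ^ 2 * T ^ (q - 2)) := by ring
          _ = _ := by rw [h3]; ring

/-- The distribution function of a Fourier transform, by splitting the function at a height. -/
theorem meas_lt_norm_fourier_le {u : V → ℂ} (hu : Integrable u) (hm : StronglyMeasurable u)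
    {q p a : ℝ} (hpq : p.HolderConjugate q) (ha : 0 < a)
    (hA : ∫⁻ x, ENNReal.ofReal (‖u x‖ ^ p) = ENNReal.ofReal a) {t : ℝ} (ht : 0 < t) :
    volume {ξ | t < ‖𝓕 u ξ‖} * ENNReal.ofReal (t ^ (q - 1)) ≤
      ∫⁻ x, (if ‖u x‖ ≤ (2 * a / t) ^ (q - 1) then ENNReal.ofReal (‖u x‖ ^ 2) else 0) *
        ENNReal.ofReal (4 * t ^ (q - 3)) := by
  have hp1 : 1 < p := hpq.lt
  have hpq1 : (p - 1) * (q - 1) = 1 := by linear_combination hpq.mul_eq_add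
  -- The height is chosen so that `γ^(p-1) = 2a/t`. Where `|u| > γ` one has `|u| ≤ γ^(1-p) |u|^p`,
  -- so the tall part of `u` has `L¹` norm at most `t/2`, and its transform never exceeds `t/2`.
  set γ : ℝ := (2 * a / t) ^ (q - 1) with hγ
  have hγ0 : 0 < γ := by positivity
  have hγp : γ ^ (p - 1) = 2 * a / t := by
    rw [hγ, ← Real.rpow_mul (by positivity), mul_comm (q - 1), hpq1, Real.rpow_one]
  set S : Set V := {x | ‖u x‖ ≤ γ} with hS
  have hSm : MeasurableSet S := measurableSet_le hm.norm.measurable measurable_const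
  have hsi : Integrable (S.indicator u) := hu.indicator hSm
  have hbi : Integrable (Sᶜ.indicator u) := hu.indicator hSm.compl
  have hs2 : MemLp (S.indicator u) 2 := by
    have htop : MemLp (S.indicator u) ∞ := by
      refine memLp_top_of_bound hsi.1 γ (Filter.Eventually.of_forall fun x => ?_)
      by_cases hx : x ∈ S
      · rw [Set.indicator_of_mem hx]; exact hx
      · rw [Set.indicator_of_notMem hx]; simpa using hγ0.le
    refine ⟨hsi.1, (eLpNorm_le_eLpNorm_one_add_eLpNorm_top _ (by norm_num)).trans_lt ?_⟩
    exact ENNReal.add_lt_top.2 ⟨(memLp_one_iff_integrable.2 hsi).2, htop.2⟩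
  have hbig : ∀ ξ, ‖𝓕 (Sᶜ.indicator u) ξ‖ ≤ t / 2 := by
    intro ξ
    have h1 : ‖𝓕 (Sᶜ.indicator u) ξ‖ₑ ≤ ENNReal.ofReal (t / 2) := by
      refine (enorm_fourier_le _ ξ).trans ?_
      calc _ ≤ ∫⁻ x, ENNReal.ofReal (t / (2 * a)) * ENNReal.ofReal (‖u x‖ ^ p) := by
            refine lintegral_mono fun x => ?_
            by_cases hx : x ∈ S
            · simp [hx]
            · rw [Set.indicator_of_mem (by exact hx), ← ofReal_norm,
                  ← ENNReal.ofReal_mul (by positivity)]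
              refine ENNReal.ofReal_le_ofReal ?_
              have hx' : γ < ‖u x‖ := not_le.1 hx
              have h0 : 0 < ‖u x‖ := hγ0.trans hx'
              have h2 : 2 * a / t ≤ ‖u x‖ ^ (p - 1) := by
                rw [← hγp]; exact Real.rpow_le_rpow hγ0.le hx'.le (by linarith)
              have h3 : ‖u x‖ ^ p = ‖u x‖ ^ (p - 1) * ‖u x‖ := by
                rw [← Real.rpow_add_one h0.ne']; congr 1; ring
              rw [h3, ← mul_assoc]
              refine le_mul_of_one_le_left h0.le ?_
              calc (1 : ℝ) = t / (2 * a) * (2 * a / t) := by field_simp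
                _ ≤ _ := by gcongr
        _ = _ := by
            rw [lintegral_const_mul' _ _ ENNReal.ofReal_ne_top, hA,
                ← ENNReal.ofReal_mul (by positivity)]
            congr 1; field_simp
    rw [← ofReal_norm] at h1
    exact (ENNReal.ofReal_le_ofReal_iff (by positivity)).1 h1
  have hsum : ∀ ξ, 𝓕 u ξ = 𝓕 (S.indicator u) ξ + 𝓕 (Sᶜ.indicator u) ξ := by
    intro ξ
    have := VectorFourier.fourierIntegral_add (e := 𝐞) (μ := (volume : Measure V)) (L := innerₗ V)
      Real.continuous_fourierChar continuous_inner hsi hbi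
    rw [Set.indicator_self_add_compl] at this
    exact congrFun this ξ
  -- Only the low part can make the transform exceed `t`. Chebyshev at level `t/2` in `L²` and
  -- Plancherel then apply to it.
  have hsub : {ξ | t < ‖𝓕 u ξ‖} ⊆
      {ξ | ENNReal.ofReal (t ^ 2 / 4) ≤ ‖𝓕 (S.indicator u) ξ‖ₑ ^ 2} := by
    intro ξ hξ
    have h1 : t / 2 ≤ ‖𝓕 (S.indicator u) ξ‖ := by
      have h2 : t < ‖𝓕 u ξ‖ := hξ
      rw [hsum] at h2
      have := norm_add_le (𝓕 (S.indicator u) ξ) (𝓕 (Sᶜ.indicator u) ξ)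
      have := hbig ξ
      linarith
    simp only [Set.mem_ofPred_eq]
    rw [← ofReal_norm, ← ENNReal.ofReal_pow (norm_nonneg _)]
    refine ENNReal.ofReal_le_ofReal ?_
    nlinarith
  have hcheb := mul_meas_ge_le_lintegral₀ (μ := volume)
    (f := fun ξ => ‖𝓕 (S.indicator u) ξ‖ₑ ^ 2)
    ((continuous_fourier hsi).enorm.measurable.pow_const 2).aemeasurable
        (ENNReal.ofReal (t ^ 2 / 4))
  rw [lintegral_enorm_fourier_sq hsi hs2] at hcheb
  rw [lintegral_mul_const' _ _ ENNReal.ofReal_ne_top]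
  have hsq : ∫⁻ x, ‖S.indicator u x‖ₑ ^ 2 =
      ∫⁻ x, (if ‖u x‖ ≤ γ then ENNReal.ofReal (‖u x‖ ^ 2) else 0) := by
    refine lintegral_congr fun x => ?_
    by_cases hx : ‖u x‖ ≤ γ
    · rw [if_pos hx, Set.indicator_of_mem (by exact hx), ← ofReal_norm,
          ENNReal.ofReal_pow (norm_nonneg _)]
    · rw [if_neg hx, Set.indicator_of_notMem (by exact hx)]; simp
  rw [← hsq]
  have hfac : ENNReal.ofReal (t ^ (q - 1)) =
      ENNReal.ofReal (t ^ 2 / 4) * ENNReal.ofReal (4 * t ^ (q - 3)) := by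
    rw [← ENNReal.ofReal_mul (by positivity)]
    congr 1
    rw [show q - 1 = (q - 3) + (2 : ℕ) by push_cast; ring, Real.rpow_add_natCast ht.ne']
    ring
  rw [hfac, ← mul_assoc]
  gcongr
  rw [mul_comm]
  exact (mul_le_mul_right (measure_mono hsub) _).trans hcheb

/-- The layer-cake formula, the distribution bound and Tonelli leave an explicit integral in the
level `t`. As `(q - 1)/q = 1/p`, a `q`-th root turns this into the norm inequality. -/
theorem lintegral_norm_fourier_rpow_le {u : V → ℂ} (hu : Integrable u) (hm : StronglyMeasurable u)
    {q p a : ℝ} (hq : 2 < q) (hpq : p.HolderConjugate q) (ha : 0 < a)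
    (hA : ∫⁻ x, ENNReal.ofReal (‖u x‖ ^ p) = ENNReal.ofReal a) :
    ∫⁻ ξ, ENNReal.ofReal (‖𝓕 u ξ‖ ^ q) ≤
      ENNReal.ofReal (q * (4 * 2 ^ (q - 2) / (q - 2)) * a ^ (q - 1)) := by
  have h2 : 0 < q - 2 := by linarith
  rw [lintegral_rpow_eq_lintegral_meas_lt_mul volume
      (Filter.Eventually.of_forall fun _ => norm_nonneg _)
    (continuous_fourier hu).norm.measurable.aemeasurable (by linarith)]
  calc _ ≤ ENNReal.ofReal q * ∫⁻ t in Set.Ioi (0 : ℝ), ∫⁻ x,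
        (if ‖u x‖ ≤ (2 * a / t) ^ (q - 1) then ENNReal.ofReal (‖u x‖ ^ 2) else 0) *
        ENNReal.ofReal (4 * t ^ (q - 3)) := by
        gcongr ENNReal.ofReal q * ?_
        exact setLIntegral_mono' measurableSet_Ioi fun t ht =>
          meas_lt_norm_fourier_le hu hm hpq ha hA ht
    _ = ENNReal.ofReal q * ∫⁻ x, ∫⁻ t in Set.Ioi (0 : ℝ),
        (if ‖u x‖ ≤ (2 * a / t) ^ (q - 1) then ENNReal.ofReal (‖u x‖ ^ 2) else 0) *
        ENNReal.ofReal (4 * t ^ (q - 3)) := by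
        congr 1
        refine lintegral_lintegral_swap (Measurable.aemeasurable ?_)
        have m1 : Measurable fun z : ℝ × V => ‖u z.2‖ := hm.norm.measurable.comp measurable_snd
        refine Measurable.mul (Measurable.ite ?_ ?_ measurable_const) ?_
        · exact measurableSet_le m1 (by fun_prop)
        · exact (m1.pow_const 2).ennreal_ofReal
        · fun_prop
    _ ≤ ENNReal.ofReal q * ∫⁻ x,
        ENNReal.ofReal (4 * (2 * a) ^ (q - 2) / (q - 2)) * ENNReal.ofReal (‖u x‖ ^ p) := by
        gcongr with x
        exact lintegral_Ioi_indicator_rpow_mul_sq hq hpq ha (norm_nonneg _)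
    _ = _ := by
        rw [lintegral_const_mul' _ _ ENNReal.ofReal_ne_top, hA,
            ← ENNReal.ofReal_mul (by positivity),
          ← ENNReal.ofReal_mul (by linarith)]
        congr 1
        rw [Real.mul_rpow (by norm_num) ha.le, show q - 1 = q - 2 + 1 by ring,
            Real.rpow_add_one ha.ne']
        ring

/-- The Hausdorff–Young inequality, up to a constant. -/
theorem exists_eLpNorm_fourier_le {r r' : ℝ≥0∞} (hr : 2 ≤ r) (hrr' : r⁻¹ + r'⁻¹ = 1) :
    ∃ C : ℝ≥0∞, C ≠ ∞ ∧ ∀ u : V → ℂ, Integrable u → eLpNorm (𝓕 u) r ≤ C * eLpNorm u r' := by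
  rcases eq_or_ne r ∞ with rfl | hrtop
  · refine ⟨1, by simp, fun u hu => ?_⟩
    obtain rfl : r' = 1 := by simpa using hrr'
    rw [one_mul, eLpNorm_one_eq_lintegral_enorm, eLpNorm_exponent_top]
    exact essSup_le_of_ae_le _ (Filter.Eventually.of_forall fun ξ => enorm_fourier_le u ξ)
  have hr0 : r ≠ 0 := (two_pos.trans_le hr).ne'
  have hr2 : 2 ≤ r.toReal := by simpa using ENNReal.toReal_mono hrtop hr
  have hr'0 : r' ≠ 0 := by
    rintro rfl
    simp at hrr'
  have hr'top : r' ≠ ∞ := by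
    rintro rfl
    rw [ENNReal.inv_top, add_zero, ENNReal.inv_eq_one] at hrr'
    rw [hrr'] at hr
    norm_num at hr
  have hconj : r'.toReal.HolderConjugate r.toReal := by
    rw [Real.holderConjugate_iff]
    have h1 : r.toReal⁻¹ + r'.toReal⁻¹ = 1 := by
      rw [← ENNReal.toReal_inv, ← ENNReal.toReal_inv, ← ENNReal.toReal_add (by simpa) (by simpa),
        hrr', ENNReal.toReal_one]
    have h2 : r.toReal⁻¹ ≤ 2⁻¹ := by gcongr
    have h3 : 0 < r.toReal⁻¹ := by positivity
    have h0 : 0 < r'.toReal := ENNReal.toReal_pos hr'0 hr'top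
    refine ⟨?_, by linarith⟩
    rw [← inv_lt_one₀ h0]
    linarith
  -- The interpolation constant has a pole at `q = 2`, so that endpoint is taken directly from
  -- Plancherel.
  rcases hr2.eq_or_lt with h2 | h2
  · obtain rfl : r = 2 := by rw [← ENNReal.ofReal_toReal hrtop, ← h2]; simp
    obtain rfl : r' = 2 := by
      have h3 := hconj.inv_add_inv_eq_inv
      rw [← h2] at h3
      have h4 : r'.toReal = 2 := by
        rw [← inv_inj]; norm_num at h3 ⊢; linarith
      rw [← ENNReal.ofReal_toReal hr'top, h4]; simp
    refine ⟨1, by simp, fun u hu => ?_⟩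
    rw [one_mul]
    by_cases hu2 : MemLp u 2
    · rw [eLpNorm_eq_lintegral_rpow_enorm_toReal (by norm_num) (by norm_num),
        eLpNorm_eq_lintegral_rpow_enorm_toReal (by norm_num) (by norm_num)]
      have := lintegral_enorm_fourier_sq hu hu2
      simp only [ENNReal.toReal_ofNat, ENNReal.rpow_ofNat]
      rw [this]
    · have : eLpNorm u 2 volume = ∞ := by
        by_contra h
        exact hu2 ⟨hu.1, lt_top_iff_ne_top.2 h⟩
      rw [this]
      exact le_top
  have hq0 : 0 < r.toReal := by linarith
  have hp0 : 0 < r'.toReal := ENNReal.toReal_pos hr'0 hr'top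
  set q := r.toReal with hq
  set p := r'.toReal with hp
  have hq2 : 0 < q - 2 := by linarith
  have hc : 0 < q * (4 * 2 ^ (q - 2) / (q - 2)) := by positivity
  refine ⟨ENNReal.ofReal (q * (4 * 2 ^ (q - 2) / (q - 2))) ^ (1 / q),
    ENNReal.rpow_ne_top_of_nonneg (by positivity) ENNReal.ofReal_ne_top, fun u hu => ?_⟩
  have hcongr : 𝓕 u = 𝓕 (hu.1.mk u) := funext fun ξ => Real.fourier_congr_ae hu.1.ae_eq_mk ξ
  rw [hcongr, eLpNorm_congr_ae hu.1.ae_eq_mk]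
  have hu' := hu.congr hu.1.ae_eq_mk
  have hm := hu.1.stronglyMeasurable_mk
  generalize hu.1.mk u = w at *
  have hconv : ∀ (k : V → ℂ) (e : ℝ), 0 ≤ e →
      ∫⁻ x, ‖k x‖ₑ ^ e = ∫⁻ x, ENNReal.ofReal (‖k x‖ ^ e) := fun k e he => by
    refine lintegral_congr fun x => ?_
    rw [← ofReal_norm, ENNReal.ofReal_rpow_of_nonneg (norm_nonneg _) he]
  rw [eLpNorm_eq_lintegral_rpow_enorm_toReal hr0 hrtop,
    eLpNorm_eq_lintegral_rpow_enorm_toReal hr'0 hr'top, ← hq, ← hp, hconv _ _ hq0.le,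
    hconv _ _ hp0.le]
  set A := ∫⁻ x, ENNReal.ofReal (‖w x‖ ^ p) with hA
  -- The interpolation bound needs `0 < A < ∞`. For `A = ∞` the right side is infinite, and for `A =
  -- 0` the transform vanishes.
  rcases eq_or_ne A ∞ with hAtop | hAtop
  · rw [hAtop, ENNReal.top_rpow_of_pos (by positivity), ENNReal.mul_top]
    · exact le_top
    · exact (ENNReal.rpow_pos (by simpa using hc) ENNReal.ofReal_ne_top).ne'
  rcases eq_or_ne A 0 with hA0 | hA0
  · have hw : w =ᵐ[volume] 0 := by
      rw [hA, lintegral_eq_zero_iff (by have := hm.measurable; fun_prop)] at hA0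
      filter_upwards [hA0] with x hx
      simp only [Pi.zero_apply, ENNReal.ofReal_eq_zero] at hx
      by_contra h
      have : 0 < ‖w x‖ := norm_pos_iff.2 h
      exact absurd hx (not_le.2 (by positivity))
    have : 𝓕 w = 0 := funext fun ξ => by
      rw [Real.fourier_congr_ae hw ξ, Real.fourier_eq]; simp
    rw [this]
    simp [Real.zero_rpow hq0.ne', hq0]
  have ha : 0 < A.toReal := ENNReal.toReal_pos hA0 hAtop
  have key := lintegral_norm_fourier_rpow_le hu' hm h2 hconj ha
    (by rw [ENNReal.ofReal_toReal hAtop])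
  rw [ENNReal.ofReal_mul hc.le, ← ENNReal.ofReal_rpow_of_nonneg ha.le (by linarith),
    ENNReal.ofReal_toReal hAtop] at key
  refine (ENNReal.rpow_le_rpow key (by positivity)).trans_eq ?_
  rw [ENNReal.mul_rpow_of_nonneg _ _ (by positivity), ← ENNReal.rpow_mul]
  congr 2
  have := hconj.mul_eq_add
  field_simp
  linarith

end Fourier

/-- Hölder's inequality for `[0, ∞]`-valued functions, for all exponents in `[1, ∞]`. -/
theorem lintegral_mul_le_eLpNorm_mul_eLpNorm {α : Type*} [MeasurableSpace α] {μ : Measure α}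
    {p q : ℝ≥0∞} (hpq : p⁻¹ + q⁻¹ = 1) {f g : α → ℝ≥0∞} (hf : AEMeasurable f μ)
    (hg : AEMeasurable g μ) : ∫⁻ x, f x * g x ∂μ ≤ eLpNorm f p μ * eLpNorm g q μ := by
  have top_case : ∀ {f g : α → ℝ≥0∞}, AEMeasurable g μ →
      ∫⁻ x, f x * g x ∂μ ≤ eLpNorm f ∞ μ * eLpNorm g 1 μ := by
    intro f g hg
    rw [eLpNorm_one_eq_lintegral_enorm]
    simp only [enorm_eq_self]
    rw [← lintegral_const_mul'' _ hg]
    refine lintegral_mono_ae ?_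
    filter_upwards [enorm_ae_le_eLpNormEssSup f μ] with x hx
    gcongr
    simpa using hx
  rcases eq_or_ne p ∞ with rfl | hp
  · obtain rfl : q = 1 := by simpa using hpq
    exact top_case hg
  rcases eq_or_ne q ∞ with rfl | hq
  · obtain rfl : p = 1 := by simpa using hpq
    rw [mul_comm]
    simp only [mul_comm (f _)]
    exact top_case hf
  have hp0 : p ≠ 0 := by rintro rfl; simp at hpq
  have hq0 : q ≠ 0 := by rintro rfl; simp at hpq
  have hc : p.toReal⁻¹ + q.toReal⁻¹ = 1 := by
    rw [← ENNReal.toReal_inv, ← ENNReal.toReal_inv, ← ENNReal.toReal_add (by simpa) (by simpa),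
      hpq, ENNReal.toReal_one]
  have hp1 : 0 < p.toReal := ENNReal.toReal_pos hp0 hp
  have hq1 : 0 < q.toReal := ENNReal.toReal_pos hq0 hq
  have hconj : p.toReal.HolderConjugate q.toReal := by
    rw [Real.holderConjugate_iff]
    refine ⟨?_, hc⟩
    rw [← inv_lt_one₀ hp1]
    have : 0 < q.toReal⁻¹ := by positivity
    linarith
  rw [eLpNorm_eq_lintegral_rpow_enorm_toReal hp0 hp, eLpNorm_eq_lintegral_rpow_enorm_toReal hq0 hq]
  simpa using ENNReal.lintegral_mul_le_Lp_mul_Lq μ hconj hf hg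

/-- This is the factorization behind Young's inequality, with `a, b, c` in the roles of `q₀, q₁,
q₂`. All exponents are nonnegative, so exponents add even at `0` and `∞`. -/
theorem mul_eq_rpow_mul_rpow {x y : ℝ≥0∞} {a b c : ℝ} (ha : 0 < a) (hb : 0 < b) (hc : 0 < c)
    (hba : a⁻¹ ≤ b⁻¹) (hca : a⁻¹ ≤ c⁻¹) :
    x * y = (x ^ b * y ^ c) ^ a⁻¹ * ((x ^ b) ^ (b⁻¹ - a⁻¹) * (y ^ c) ^ (c⁻¹ - a⁻¹)) := by
  have key : ∀ (x : ℝ≥0∞) {b : ℝ}, 0 < b → a⁻¹ ≤ b⁻¹ →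
      (x ^ b) ^ a⁻¹ * (x ^ b) ^ (b⁻¹ - a⁻¹) = x := by
    intro x b hb hba
    rw [← ENNReal.rpow_add_of_nonneg _ _ (by positivity) (by linarith), ← ENNReal.rpow_mul,
      add_sub_cancel, mul_inv_cancel₀ hb.ne', ENNReal.rpow_one]
  rw [ENNReal.mul_rpow_of_nonneg _ _ (by positivity), mul_mul_mul_comm, key x hb hba, key y hc hca]

/-! ### Young's convolution inequality and a Minkowski bound -/

section Young

variable {V : Type*} [NormedAddCommGroup V] [InnerProductSpace ℝ V] [FiniteDimensional ℝ V]
  [MeasurableSpace V] [BorelSpace V]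

theorem measurable_lconv {f h : V → ℝ≥0∞} (hf : Measurable f) (hh : Measurable h) :
    Measurable fun η : V => ∫⁻ ω, f ω * h (η - ω) :=
  Measurable.lintegral_prod_right' (f := fun z : V × V => f z.2 * h (z.1 - z.2)) (by fun_prop)

theorem lintegral_lconv {f h : V → ℝ≥0∞} (hf : Measurable f) (hh : Measurable h) :
    ∫⁻ η : V, ∫⁻ ω, f ω * h (η - ω) = (∫⁻ ω, f ω) * ∫⁻ ω, h ω := by
  rw [lintegral_lintegral_swap (by fun_prop)]
  rw [← lintegral_mul_const _ hf]
  refine lintegral_congr fun ω => ?_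
  rw [lintegral_const_mul _ (by fun_prop), lintegral_sub_right_eq_self]

/-- Young's convolution inequality for `[0, ∞]`-valued functions. -/
theorem eLpNorm_lconv_le {q₀ q₁ q₂ : ℝ≥0∞} (h₀ : 1 ≤ q₀) (h₁ : 1 ≤ q₁) (h₂ : 1 ≤ q₂)
    (hq : q₀⁻¹ + 1 = q₁⁻¹ + q₂⁻¹) {f h : V → ℝ≥0∞} (hf : Measurable f) (hh : Measurable h) :
    eLpNorm (fun η : V => ∫⁻ ω, f ω * h (η - ω)) q₀ ≤ eLpNorm f q₁ * eLpNorm h q₂ := by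
  -- For `q₀ = ∞` the exponents `q₁, q₂` are conjugate, and the claim is Hölder for each `η`.
  rcases eq_or_ne q₀ ∞ with rfl | h₀top
  · rw [eLpNorm_exponent_top]
    refine essSup_le_of_ae_le _ (Filter.Eventually.of_forall fun η => ?_)
    simp only [enorm_eq_self]
    rw [← eLpNorm_comp_measurePreserving (p := q₂) hh.aestronglyMeasurable
      (Measure.measurePreserving_sub_left volume η)]
    exact lintegral_mul_le_eLpNorm_mul_eLpNorm (by simpa using hq.symm) hf.aemeasurable
      (hh.comp (measurable_const_sub η)).aemeasurable
  have hinv : ∀ {q q' : ℝ≥0∞}, 1 ≤ q → q₀⁻¹ + 1 = q'⁻¹ + q⁻¹ → q₀⁻¹ ≤ q'⁻¹ := by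
    intro q q' hq h
    have : q⁻¹ ≤ 1 := ENNReal.inv_le_one.2 hq
    refine (ENNReal.add_le_add_iff_right ENNReal.one_ne_top).1 (h.trans_le ?_)
    gcongr
  have hi₁ : q₀⁻¹ ≤ q₁⁻¹ := hinv h₂ hq
  have hi₂ : q₀⁻¹ ≤ q₂⁻¹ := hinv h₁ (by rw [hq, add_comm])
  have h₁top : q₁ ≠ ∞ := fun h => h₀top (by simpa [h] using hi₁)
  have h₂top : q₂ ≠ ∞ := fun h => h₀top (by simpa [h] using hi₂)
  have n₀ : q₀ ≠ 0 := (zero_lt_one.trans_le h₀).ne'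
  have n₁ : q₁ ≠ 0 := (zero_lt_one.trans_le h₁).ne'
  have n₂ : q₂ ≠ 0 := (zero_lt_one.trans_le h₂).ne'
  have hr₁ : q₀.toReal⁻¹ ≤ q₁.toReal⁻¹ := by
    simpa [ENNReal.toReal_inv] using ENNReal.toReal_mono (by simpa using n₁) hi₁
  have hr₂ : q₀.toReal⁻¹ ≤ q₂.toReal⁻¹ := by
    simpa [ENNReal.toReal_inv] using ENNReal.toReal_mono (by simpa using n₂) hi₂
  have hr : q₀.toReal⁻¹ + 1 = q₁.toReal⁻¹ + q₂.toReal⁻¹ := by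
    have := congrArg ENNReal.toReal hq
    rwa [ENNReal.toReal_add (by simpa) (by simp), ENNReal.toReal_add (by simpa) (by simpa),
      ENNReal.toReal_inv, ENNReal.toReal_inv, ENNReal.toReal_inv, ENNReal.toReal_one] at this
  rw [eLpNorm_eq_lintegral_rpow_enorm_toReal n₀ h₀top,
    eLpNorm_eq_lintegral_rpow_enorm_toReal n₁ h₁top,
    eLpNorm_eq_lintegral_rpow_enorm_toReal n₂ h₂top]
  simp only [enorm_eq_self, one_div]
  have ha := ENNReal.toReal_pos n₀ h₀top
  have hb := ENNReal.toReal_pos n₁ h₁top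
  have hc := ENNReal.toReal_pos n₂ h₂top
  set a := q₀.toReal
  set b := q₁.toReal
  set c := q₂.toReal
  set I := ∫⁻ ω, f ω ^ b with hI
  set J := ∫⁻ ω, h ω ^ c with hJ
  have hpt : ∀ η : V, (∫⁻ ω, f ω * h (η - ω)) ^ a ≤
      (∫⁻ ω, f ω ^ b * h (η - ω) ^ c) * (I ^ (b⁻¹ - a⁻¹) * J ^ (c⁻¹ - a⁻¹)) ^ a := by
    intro η
    -- Three-factor Hölder: Young's relation says precisely that `1/a + (1/b - 1/a) + (1/c - 1/a) =
    -- 1`.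
    have h3 := ENNReal.lintegral_prod_norm_pow_le (μ := (volume : Measure V))
        (Finset.univ : Finset (Fin 3))
      (f := ![fun ω => f ω ^ b * h (η - ω) ^ c, fun ω => f ω ^ b, fun ω => h (η - ω) ^ c])
      (p := ![a⁻¹, b⁻¹ - a⁻¹, c⁻¹ - a⁻¹])
      (by
        intro i _
        fin_cases i <;> simp <;> fun_prop)
      (by simp [Fin.sum_univ_three]; linarith)
      (by
        intro i _
        fin_cases i
        · simpa using ha.le
        · simpa using hr₁
        · simpa using hr₂)
    simp only [Fin.prod_univ_three, Matrix.cons_val_zero, Matrix.cons_val_one, Matrix.cons_val]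
      at h3
    have h4 : ∫⁻ ω, f ω * h (η - ω) ≤ (∫⁻ ω, f ω ^ b * h (η - ω) ^ c) ^ a⁻¹ *
        (I ^ (b⁻¹ - a⁻¹) * J ^ (c⁻¹ - a⁻¹)) := by
      rw [lintegral_sub_left_eq_self (fun ω => h ω ^ c) η] at h3
      rw [← mul_assoc]
      refine le_trans (le_of_eq ?_) h3
      refine lintegral_congr fun ω => ?_
      rw [mul_assoc]
      exact mul_eq_rpow_mul_rpow ha hb hc hr₁ hr₂
    refine (ENNReal.rpow_le_rpow h4 ha.le).trans_eq ?_
    rw [ENNReal.mul_rpow_of_nonneg _ _ ha.le, ← ENNReal.rpow_mul, inv_mul_cancel₀ ha.ne',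
      ENNReal.rpow_one]
  calc (∫⁻ η : V, (∫⁻ ω, f ω * h (η - ω)) ^ a) ^ a⁻¹
      ≤ (∫⁻ η : V, (∫⁻ ω, f ω ^ b * h (η - ω) ^ c) *
          (I ^ (b⁻¹ - a⁻¹) * J ^ (c⁻¹ - a⁻¹)) ^ a) ^ a⁻¹ := by
        gcongr
        exact hpt _
    _ = (I * J) ^ a⁻¹ * (I ^ (b⁻¹ - a⁻¹) * J ^ (c⁻¹ - a⁻¹)) := by
        rw [lintegral_mul_const _ (measurable_lconv (hf.pow_const b) (hh.pow_const c)),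
          lintegral_lconv (hf.pow_const b) (hh.pow_const c),
              ENNReal.mul_rpow_of_nonneg _ _ (by positivity),
          ← ENNReal.rpow_mul _ a, mul_inv_cancel₀ ha.ne', ENNReal.rpow_one]
    _ = I ^ b⁻¹ * J ^ c⁻¹ := by
        have key : ∀ (x : ℝ≥0∞) {b : ℝ}, 0 < b → a⁻¹ ≤ b⁻¹ →
            x ^ a⁻¹ * x ^ (b⁻¹ - a⁻¹) = x ^ b⁻¹ := by
          intro x b hb hba
          rw [← ENNReal.rpow_add_of_nonneg _ _ (by positivity) (by linarith), add_sub_cancel]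
        rw [ENNReal.mul_rpow_of_nonneg _ _ (by positivity), mul_mul_mul_comm, key I hb hr₁,
            key J hc hr₂]

/-- A consequence of Minkowski's inequality for translates of a function. -/
theorem eLpNorm_eLpNorm_mul_translate_le {e q : ℝ≥0∞} (he : 1 ≤ e) (htop : e ≠ ∞) (heq : e ≤ q)
    {γ k : V → ℝ≥0∞} (hγ : Measurable γ) (hk : Measurable k) :
    eLpNorm (fun ω : V => eLpNorm (fun ζ : V => γ ζ * k (ζ + ω)) e) q ≤
      eLpNorm γ e * eLpNorm k q := by
  have n₀ : e ≠ 0 := (zero_lt_one.trans_le he).ne'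
  have hpos := ENNReal.toReal_pos n₀ htop
  set a := e.toReal with ha
  have hae : ENNReal.ofReal a = e := ENNReal.ofReal_toReal htop
  -- The `e`-th power of the inner norm is the convolution of `γ(-·)^e` with `k^e`. Young with
  -- exponents `1` and `s = q/e ≥ 1` therefore gives the claim.
  set s := q / e with hs
  have hsq : s * ENNReal.ofReal a = q := by rw [hae]; exact ENNReal.div_mul_cancel n₀ htop
  have hs1 : 1 ≤ s := by rwa [hs, ENNReal.le_div_iff_mul_le (Or.inl n₀) (Or.inl htop), one_mul]
  have hy := eLpNorm_lconv_le (q₀ := s) (q₁ := 1) (q₂ := s) hs1 le_rfl hs1 (by simp [add_comm])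
    (f := fun ζ => γ (-ζ) ^ a) (h := fun ζ => k ζ ^ a) (by fun_prop) (by fun_prop)
  have e1 : eLpNorm (fun ζ : V => k ζ ^ a) s = eLpNorm k q ^ a := by
    have := eLpNorm_enorm_rpow (μ := (volume : Measure V)) (p := s) k hpos
    rw [hsq] at this
    simpa using this
  have e2 : eLpNorm (fun ζ : V => γ (-ζ) ^ a) 1 = eLpNorm γ e ^ a := by
    rw [eLpNorm_one_eq_lintegral_enorm, eLpNorm_eq_lintegral_rpow_enorm_toReal n₀ htop,
        ← ENNReal.rpow_mul]
    simp only [enorm_eq_self, ← ha]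
    rw [one_div_mul_cancel hpos.ne', ENNReal.rpow_one]
    exact lintegral_neg_eq_self (fun x => γ x ^ a)
  have e3 : eLpNorm (fun η : V => ∫⁻ ω, γ (-ω) ^ a * k (η - ω) ^ a) s =
      eLpNorm (fun ω : V => eLpNorm (fun ζ : V => γ ζ * k (ζ + ω)) e) q ^ a := by
    have := eLpNorm_enorm_rpow (μ := (volume : Measure V)) (p := s)
      (fun ω : V => eLpNorm (fun ζ : V => γ ζ * k (ζ + ω)) e) hpos
    rw [hsq] at this
    rw [← this]
    congr 1
    ext ω
    rw [enorm_eq_self, eLpNorm_eq_lintegral_rpow_enorm_toReal n₀ htop, ← ENNReal.rpow_mul, ← ha,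
      one_div_mul_cancel hpos.ne', ENNReal.rpow_one, ← lintegral_neg_eq_self]
    refine lintegral_congr fun ζ => ?_
    rw [enorm_eq_self, ENNReal.mul_rpow_of_nonneg _ _ hpos.le]
    congr 3
    · simp
    · simp [sub_eq_add_neg, add_comm]
  rw [e1, e2, e3, ← ENNReal.mul_rpow_of_nonneg _ _ hpos.le, ENNReal.rpow_le_rpow_iff hpos] at hy
  exact hy

end Young

/-! ### Polynomial weights -/

section Weights

variable {V : Type*} [NormedAddCommGroup V]

theorem bracketPow_zero (x : V) : bracketPow 0 x = 1 := by simp [bracketPow]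

theorem bracketPow_mul (a b : ℝ) (x : V) :
    bracketPow a x * bracketPow b x = bracketPow (a + b) x := by
  unfold bracketPow
  rw [← Real.rpow_add (by positivity)]
  congr 1
  ring

theorem bracketPow_mul_neg (a : ℝ) (x : V) : bracketPow a x * bracketPow (-a) x = 1 := by
  rw [bracketPow_mul, add_neg_cancel, bracketPow_zero]

theorem bracketPow_le_of_le {a b : ℝ} (h : a ≤ b) (x : V) : bracketPow a x ≤ bracketPow b x := by
  unfold bracketPow
  refine Real.rpow_le_rpow_of_exponent_le ?_ (by linarith)
  nlinarith [sq_nonneg ‖x‖]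

theorem one_le_bracketPow {a : ℝ} (h : 0 ≤ a) (x : V) : 1 ≤ bracketPow a x := by
  rw [← bracketPow_zero x]
  exact bracketPow_le_of_le h x

theorem bracketPow_neg_arg (a : ℝ) (x : V) : bracketPow a (-x) = bracketPow a x := by
  simp [bracketPow]

theorem bracketPow_add_le_of_nonneg {t : ℝ} (ht : 0 ≤ t) (x y : V) :
    bracketPow t (x + y) ≤ 2 ^ (t / 2) * (bracketPow t x * bracketPow t y) := by
  unfold bracketPow
  rw [← Real.mul_rpow (by positivity) (by positivity),
    ← Real.mul_rpow (by positivity) (by positivity)]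
  refine Real.rpow_le_rpow (by positivity) ?_ (by positivity)
  have h1 := norm_add_le x y
  have h2 : ‖x + y‖ ^ 2 ≤ (‖x‖ + ‖y‖) ^ 2 := by gcongr
  nlinarith [sq_nonneg (‖x‖ - ‖y‖), sq_nonneg (‖x‖ * ‖y‖)]

/-- Peetre's inequality. -/
theorem bracketPow_add_le (t : ℝ) (x y : V) :
    bracketPow t (x + y) ≤ 2 ^ (|t| / 2) * (bracketPow t x * bracketPow |t| y) := by
  rcases le_total 0 t with ht | ht
  · rw [abs_of_nonneg ht]
    exact bracketPow_add_le_of_nonneg ht x y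
  · rw [abs_of_nonpos ht]
    -- A negative exponent follows from the positive one applied to `x = (x + y) + (-y)`, after
    -- multiplying by the reciprocal weights at `x` and `x + y`.
    have h := bracketPow_add_le_of_nonneg (neg_nonneg.2 ht) (x + y) (-y)
    rw [add_neg_cancel_right, bracketPow_neg_arg] at h
    calc bracketPow t (x + y) = bracketPow t x * bracketPow t (x + y) * bracketPow (-t) x := by
          linear_combination -(bracketPow t (x + y)) * bracketPow_mul_neg t x
      _ ≤ bracketPow t x * bracketPow t (x + y) *
          (2 ^ (-t / 2) * (bracketPow (-t) (x + y) * bracketPow (-t) y)) := by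
          have := bracketPow_pos t x
          have := bracketPow_pos t (x + y)
          gcongr
      _ = _ := by
          linear_combination (bracketPow t x * 2 ^ (-t / 2) * bracketPow (-t) y) *
            bracketPow_mul_neg t (x + y)

/-- At most one of `s₁, s₂` is negative. If it is `a`, Peetre's inequality costs the power `-a` of
the other bracket, which the other exponent covers as the sum is nonnegative. If neither is, the
power `min s₁ s₂` is submultiplicative up to a constant. -/
theorem exists_bracketPow_add_le_mul {s s₁ s₂ : ℝ} (h : 0 ≤ s₁ + s₂) (hs : s ≤ min s₁ s₂) :
    ∃ C : ℝ, 0 ≤ C ∧ ∀ x y : V, bracketPow s (x + y) ≤ C * (bracketPow s₁ x * bracketPow s₂ y) := by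
  have neg_case : ∀ {a b : ℝ}, 0 ≤ a + b → s ≤ a → a < 0 → ∀ x y : V,
      bracketPow s (x + y) ≤ 2 ^ (-a / 2) * (bracketPow a x * bracketPow b y) := by
    intro a b hab hsa ha x y
    have h1 := bracketPow_add_le_of_nonneg (neg_nonneg.2 ha.le) (x + y) (-y)
    rw [add_neg_cancel_right, bracketPow_neg_arg] at h1
    have p1 := bracketPow_pos a x
    have p2 := bracketPow_pos a (x + y)
    have p3 := bracketPow_pos (-a) (x + y)
    calc bracketPow s (x + y) ≤ bracketPow a (x + y) := bracketPow_le_of_le hsa _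
      _ = bracketPow a x * bracketPow a (x + y) * bracketPow (-a) x := by
          linear_combination -(bracketPow a (x + y)) * bracketPow_mul_neg a x
      _ ≤ bracketPow a x * bracketPow a (x + y) *
          (2 ^ (-a / 2) * (bracketPow (-a) (x + y) * bracketPow (-a) y)) := by gcongr
      _ = 2 ^ (-a / 2) * (bracketPow a x * bracketPow (-a) y) := by
          linear_combination (bracketPow a x * 2 ^ (-a / 2) * bracketPow (-a) y) *
            bracketPow_mul_neg a (x + y)
      _ ≤ _ := by
          have := bracketPow_le_of_le (a := -a) (b := b) (by linarith) y
          gcongr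
  have hs₁ := hs.trans (min_le_left _ _)
  have hs₂ := hs.trans (min_le_right _ _)
  rcases lt_or_ge s₁ 0 with h₁ | h₁
  · exact ⟨_, by positivity, neg_case h hs₁ h₁⟩
  rcases lt_or_ge s₂ 0 with h₂ | h₂
  · refine ⟨2 ^ (-s₂ / 2), by positivity, fun x y => ?_⟩
    rw [add_comm x, mul_comm (bracketPow s₁ x)]
    exact neg_case (by linarith) hs₂ h₂ y x
  refine ⟨2 ^ (min s₁ s₂ / 2), by positivity, fun x y => ?_⟩
  have p1 := bracketPow_pos s₁ x
  have p2 := bracketPow_pos (min s₁ s₂) y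
  calc bracketPow s (x + y) ≤ bracketPow (min s₁ s₂) (x + y) := bracketPow_le_of_le hs _
    _ ≤ _ := bracketPow_add_le_of_nonneg (le_min h₁ h₂) x y
    _ ≤ _ := by
      have := bracketPow_le_of_le (min_le_left s₁ s₂) x
      have := bracketPow_le_of_le (min_le_right s₁ s₂) y
      gcongr

/-- The submultiplicativity of the weights which governs the Gabor product. -/
theorem exists_bracketPow_le_mul_mul {s s₁ s₂ : ℝ} (h : 0 ≤ s₁ + s₂) (hs : s ≤ min s₁ s₂) :
    ∃ C : ℝ, 0 ≤ C ∧ ∀ ω ζ x y : V, x + y = ζ + ω →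
      bracketPow s ω ≤ C * (bracketPow |s| ζ * (bracketPow s₁ x * bracketPow s₂ y)) := by
  obtain ⟨C, hC, hb⟩ := exists_bracketPow_add_le_mul (V := V) h hs
  refine ⟨2 ^ (|s| / 2) * C, by positivity, fun ω ζ x y hxy => ?_⟩
  -- Peetre replaces `ω` by `ζ + ω = x + y` at the cost of `⟨ζ⟩^|s|`.
  have h1 := bracketPow_add_le s (ζ + ω) (-ζ)
  rw [add_neg_cancel_comm, bracketPow_neg_arg, ← hxy] at h1
  have p1 := bracketPow_pos |s| ζ
  calc _ ≤ _ := h1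
    _ ≤ 2 ^ (|s| / 2) * (C * (bracketPow s₁ x * bracketPow s₂ y) * bracketPow |s| ζ) := by
      gcongr
      exact hb x y
    _ = _ := by ring

theorem exists_one_add_pow_le_exp (n : ℕ) :
    ∃ C : ℝ, 0 < C ∧ ∀ y : ℝ, 0 ≤ y → (1 + y) ^ n ≤ C * Real.exp y := by
  -- The `n`-th power of `1 + y ≤ (n + 1) exp (y / (n + 1))` has exponent `n y / (n + 1) ≤ y`;
  -- dividing by `n + 1` rather than `n` includes `n = 0`.
  refine ⟨(n + 1 : ℝ) ^ n, by positivity, fun y hy => ?_⟩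
  have h1 : 1 + y ≤ (n + 1 : ℝ) * Real.exp (y / (n + 1)) := by
    have := Real.add_one_le_exp (y / (n + 1))
    have hn : (0 : ℝ) < n + 1 := by positivity
    calc 1 + y ≤ (n + 1) * (y / (n + 1) + 1) := by
          have : (0 : ℝ) ≤ n := by positivity
          field_simp
          linarith
      _ ≤ _ := by gcongr
  calc (1 + y) ^ n ≤ ((n + 1 : ℝ) * Real.exp (y / (n + 1))) ^ n := by gcongr
    _ = (n + 1 : ℝ) ^ n * Real.exp (n * (y / (n + 1))) := by rw [mul_pow, Real.exp_nat_mul]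
    _ ≤ _ := by
      gcongr
      rw [mul_div_assoc', div_le_iff₀ (by positivity)]
      nlinarith

theorem exists_bracketPow_le_exp (t : ℝ) :
    ∃ C : ℝ, 0 < C ∧ ∀ x : V, bracketPow t x ≤ C * Real.exp ‖x‖ := by
  obtain ⟨n, hn⟩ := exists_nat_ge t
  obtain ⟨C, hC, hb⟩ := exists_one_add_pow_le_exp n
  refine ⟨C, hC, fun x => le_trans ?_ (hb _ (norm_nonneg x))⟩
  calc bracketPow t x ≤ bracketPow n x := bracketPow_le_of_le hn x
    _ ≤ ((1 + ‖x‖) ^ 2) ^ ((n : ℝ) / 2) := by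
      unfold bracketPow
      refine Real.rpow_le_rpow (by positivity) ?_ (by positivity)
      nlinarith [norm_nonneg x]
    _ = _ := by
      rw [← Real.rpow_natCast, ← Real.rpow_natCast, ← Real.rpow_mul (by positivity)]
      congr 1
      push_cast
      ring

theorem integrable_exp_neg_norm [NormedSpace ℝ V] [FiniteDimensional ℝ V] [MeasurableSpace V]
    [BorelSpace V] {μ : Measure V} [μ.IsAddHaarMeasure] :
    Integrable (fun x : V => Real.exp (-‖x‖)) μ := by
  set n := Module.finrank ℝ V + 1
  obtain ⟨C, hC, hb⟩ := exists_one_add_pow_le_exp n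
  have h := (integrable_one_add_norm (E := V) (μ := μ) (r := n) (by simp [n])).const_mul C
  refine h.mono' (by fun_prop) (Filter.Eventually.of_forall fun x => ?_)
  rw [Real.norm_of_nonneg (Real.exp_pos _).le, Real.exp_neg, Real.rpow_neg (by positivity),
    Real.rpow_natCast, ← div_eq_mul_inv, le_div_iff₀ (by positivity),
        inv_mul_le_iff₀ (Real.exp_pos _),
    mul_comm]
  exact hb _ (norm_nonneg x)

end Weights

theorem exists_norm_le_exp_neg {V : Type*} [NormedAddCommGroup V] {ψ : V → ℂ} {h : ℝ}
    (hb : ∃ C : ℝ, ∀ x, ‖ψ x‖ * Real.exp (h * ‖x‖) ≤ C) :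
    ∃ C : ℝ, 0 ≤ C ∧ ∀ x, ‖ψ x‖ ≤ C * Real.exp (-(h * ‖x‖)) := by
  obtain ⟨C, hC⟩ := hb
  refine ⟨C, (by positivity : (0 : ℝ) ≤ _).trans (hC 0), fun x => ?_⟩
  rw [Real.exp_neg, ← div_eq_mul_inv, le_div_iff₀ (Real.exp_pos _)]
  exact hC x

/-! ### Modulation spaces and the short-time Fourier transform -/

section Modulation

variable {V : Type*} [NormedAddCommGroup V] [InnerProductSpace ℝ V] [FiniteDimensional ℝ V]
  [MeasurableSpace V] [BorelSpace V]

theorem IsGelfandShilov.continuous {φ : V → ℂ} (hφ : IsGelfandShilov φ) : Continuous φ :=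
  hφ.1.continuous

theorem IsGelfandShilov.integrable {φ : V → ℂ} (hφ : IsGelfandShilov φ) : Integrable φ := by
  obtain ⟨C, -, hC⟩ := exists_norm_le_exp_neg (hφ.2 1 one_pos).1
  exact (integrable_exp_neg_norm.const_mul C).mono' hφ.continuous.aestronglyMeasurable
    (Filter.Eventually.of_forall fun x => by simpa using hC x)

theorem IsGelfandShilov.memLp_two {φ : V → ℂ} (hφ : IsGelfandShilov φ) : MemLp φ 2 := by
  obtain ⟨C, -, hC⟩ := exists_norm_le_exp_neg (hφ.2 1 one_pos).1
  have htop : MemLp φ ∞ := by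
    refine memLp_top_of_bound hφ.continuous.aestronglyMeasurable C
      (Filter.Eventually.of_forall fun x => (hC x).trans ?_)
    have h0 : 0 ≤ C := nonneg_of_mul_nonneg_left ((norm_nonneg _).trans (hC x)) (Real.exp_pos _)
    exact mul_le_of_le_one_right h0 (Real.exp_le_one_iff.2 (by simp))
  refine ⟨htop.1, (eLpNorm_le_eLpNorm_one_add_eLpNorm_top _ (by norm_num)).trans_lt ?_⟩
  exact ENNReal.add_lt_top.2 ⟨(memLp_one_iff_integrable.2 hφ.integrable).2, htop.2⟩

theorem IsGelfandShilov.fourier_ne_zero {φ : V → ℂ} (hφ : IsGelfandShilov φ) (h0 : φ ≠ 0) :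
    ∃ ξ, 𝓕 φ ξ ≠ 0 := by
  by_contra! h
  have h1 : 𝓕 φ = 0 := funext h
  refine h0 ?_
  have h2 := hφ.continuous.fourierInv_fourier_eq hφ.integrable
      (by rw [h1]; exact integrable_zero _ _ _)
  rw [← h2, h1]
  ext x
  rw [Real.fourierInv_eq]
  simp

theorem norm_fourier_conj_translate (φ : V → ℂ) (x ω : V) :
    ‖𝓕 (fun t => conj (φ (t - x))) ω‖ = ‖𝓕 φ (-ω)‖ := by
  have h1 : 𝓕 (fun t => conj (φ (t - x))) ω =
      conj (∫ t, Complex.exp ((-2 * Real.pi * inner ℝ (t + x) (-ω) : ℝ) * Complex.I) • φ t) := by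
    rw [Real.fourier_eq', ← integral_conj, ← integral_add_right_eq_self _ x]
    refine integral_congr_ae (Filter.Eventually.of_forall fun t => ?_)
    simp only [smul_eq_mul, map_mul, add_sub_cancel_right, ← Complex.exp_conj, Complex.conj_ofReal,
      Complex.conj_I]
    congr 2
    simp [inner_neg_right]
  rw [h1, RCLike.norm_conj, Real.fourier_eq']
  have h2 : ∀ t : V, Complex.exp ((-2 * Real.pi * inner ℝ (t + x) (-ω) : ℝ) * Complex.I) • φ t =
      Complex.exp ((-2 * Real.pi * inner ℝ x (-ω) : ℝ) * Complex.I) *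
        (Complex.exp ((-2 * Real.pi * inner ℝ t (-ω) : ℝ) * Complex.I) • φ t) := by
    intro t
    rw [smul_eq_mul, smul_eq_mul, ← mul_assoc, ← Complex.exp_add]
    congr 2
    rw [inner_add_left]
    push_cast
    ring
  simp_rw [h2]
  rw [integral_const_mul, norm_mul, Complex.norm_exp_ofReal_mul_I, one_mul]

/-- This makes `f · conj φ(· - x)` integrable for every `f` that pairs with the test space, so the
STFT at `x` is the Fourier transform of an integrable function. -/
theorem IsGelfandShilov.conj_translate {φ : V → ℂ} (hφ : IsGelfandShilov φ) (x : V) :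
    IsGelfandShilov fun t => conj (φ (t - x)) := by
  refine ⟨?_, fun h hh => ⟨?_, ?_⟩⟩
  · exact Complex.conjCLE.contDiff.comp (hφ.1.comp (contDiff_id.sub contDiff_const))
  · obtain ⟨C, hC⟩ := (hφ.2 h hh).1
    refine ⟨C * Real.exp (h * ‖x‖), fun t => ?_⟩
    rw [RCLike.norm_conj]
    calc ‖φ (t - x)‖ * Real.exp (h * ‖t‖)
        ≤ ‖φ (t - x)‖ * Real.exp (h * ‖t - x‖ + h * ‖x‖) := by
          gcongr
          rw [← mul_add]
          gcongr
          simpa using norm_add_le (t - x) x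
      _ = ‖φ (t - x)‖ * Real.exp (h * ‖t - x‖) * Real.exp (h * ‖x‖) := by
          rw [Real.exp_add, mul_assoc]
      _ ≤ _ := by gcongr; exact hC _
  · obtain ⟨C, hC⟩ := (hφ.2 h hh).2
    refine ⟨C, fun ω => ?_⟩
    rw [norm_fourier_conj_translate]
    simpa using hC (-ω)

theorem stft_eq_fourier (φ f : V → ℂ) (x ω : V) :
    stft φ f x ω = 𝓕 (fun t => f t * conj (φ (t - x))) ω := by
  rw [Real.fourier_eq']
  refine integral_congr_ae (Filter.Eventually.of_forall fun t => ?_)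
  simp only [smul_eq_mul]
  rw [mul_comm, real_inner_comm]
  congr 3
  push_cast
  ring

theorem stft_congr {f g : V → ℂ} (h : f =ᵐ[volume] g) (φ : V → ℂ) (x ω : V) :
    stft φ f x ω = stft φ g x ω := by
  refine integral_congr_ae ?_
  filter_upwards [h] with t ht
  rw [ht]

theorem stronglyMeasurable_stft {φ f : V → ℂ} (hφ : Continuous φ) (hf : StronglyMeasurable f) :
    StronglyMeasurable fun z : V × V => stft φ f z.1 z.2 := by
  have h : StronglyMeasurable fun y : (V × V) × V => f y.2 * conj (φ (y.2 - y.1.1)) *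
      Complex.exp (-(2 * Real.pi * inner ℝ y.1.2 y.2 : ℝ) * Complex.I) := by
    refine ((hf.comp_measurable measurable_snd).mul ?_).mul ?_
    · refine Continuous.stronglyMeasurable ?_
      fun_prop
    · refine Continuous.stronglyMeasurable ?_
      fun_prop
  exact h.integral_prod_right'

theorem measurable_lintegral_stft {φ f : V → ℂ} (hφ : Continuous φ)
    (hf : AEStronglyMeasurable f) : Measurable fun x : V => ∫⁻ ω, ‖stft φ f x ω‖ₑ := by
  simp_rw [stft_congr hf.ae_eq_mk]
  exact (stronglyMeasurable_stft hφ hf.stronglyMeasurable_mk).enorm.lintegral_prod_right'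

/-- In `ω` the STFT is the Fourier transform of `f · conj φ(· - x)`. When it is integrable,
inversion bounds that function by the `L¹` norm of its transform; otherwise the bound is trivial. -/
theorem ae_enorm_mul_enorm_window_le {φ f : V → ℂ} (hφ : IsGelfandShilov φ)
    (hf : ∀ ψ : V → ℂ, IsGelfandShilov ψ → Integrable (fun x => f x * ψ x)) (x : V) :
    ∀ᵐ t, ‖f t‖ₑ * ‖φ (t - x)‖ₑ ≤ ∫⁻ ω, ‖stft φ f x ω‖ₑ := by
  rcases eq_or_ne (∫⁻ ω, ‖stft φ f x ω‖ₑ) ∞ with h | h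
  · simp [h]
  have hi := hf _ (hφ.conj_translate x)
  simp_rw [stft_eq_fourier] at h ⊢
  have hi' : Integrable (𝓕 fun t => f t * conj (φ (t - x))) :=
    ⟨(continuous_fourier hi).aestronglyMeasurable, lt_top_iff_ne_top.2 h⟩
  filter_upwards [fourierInv_fourier_ae_eq hi hi'] with t ht
  have : ‖f t‖ₑ * ‖φ (t - x)‖ₑ = ‖f t * conj (φ (t - x))‖ₑ := by
    rw [enorm_mul]
    congr 1
    rw [← ofReal_norm, ← ofReal_norm, RCLike.norm_conj]
  rw [this, ← ht, Real.fourierInv_eq_fourier_neg]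
  exact enorm_fourier_le _ _

/-- A function is dominated by the convolution of the `ω`-integral of its short-time Fourier
transform with the window. -/
theorem exists_enorm_le_lintegral_stft {φ f : V → ℂ} (hφ : IsGelfandShilov φ) (h0 : φ ≠ 0)
    (hm : AEStronglyMeasurable f)
    (hf : ∀ ψ : V → ℂ, IsGelfandShilov ψ → Integrable (fun x => f x * ψ x)) :
    ∃ c : ℝ≥0∞, c ≠ ∞ ∧ ∀ᵐ t, ‖f t‖ₑ ≤ c * ∫⁻ x, (∫⁻ ω, ‖stft φ f x ω‖ₑ) * ‖φ (t - x)‖ₑ := by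
  set G : V → ℝ≥0∞ := fun x => ∫⁻ ω, ‖stft φ f x ω‖ₑ with hG
  have hGm : Measurable G := measurable_lintegral_stft hφ.continuous hm
  set N := ∫⁻ x, ‖φ x‖ₑ ^ 2 with hN
  have hφm := hφ.continuous.measurable
  have hN0 : N ≠ 0 := by
    intro h
    rw [hN, lintegral_eq_zero_iff (by fun_prop)] at h
    refine h0 ((hφ.continuous.ae_eq_iff_eq volume continuous_zero).1 ?_)
    filter_upwards [h] with x hx
    simpa using hx
  -- Multiplying the pointwise bound by `|φ(t - x)|` and integrating over `x` leaves `|f(t)| ‖φ‖₂²`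
  -- on the left, whence the constant.
  refine ⟨N⁻¹, ENNReal.inv_ne_top.2 hN0, ?_⟩
  -- The exceptional set of `t` depends on `x`. Fubini exchanges the quantifiers, for which a
  -- measurable representative of `f` is needed.
  have h1 : ∀ᵐ t, ∀ᵐ x, ‖hm.mk f t‖ₑ * ‖φ (t - x)‖ₑ ≤ G x := by
    have hset : MeasurableSet {z : V × V | ‖hm.mk f z.1‖ₑ * ‖φ (z.1 - z.2)‖ₑ ≤ G z.2} := by
      have := hm.stronglyMeasurable_mk.measurable
      exact measurableSet_le (by fun_prop) (by fun_prop)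
    refine (Measure.ae_ae_comm (p := fun t x => ‖hm.mk f t‖ₑ * ‖φ (t - x)‖ₑ ≤ G x) hset).2 ?_
    refine Filter.Eventually.of_forall fun x => ?_
    filter_upwards [ae_enorm_mul_enorm_window_le hφ hf x, hm.ae_eq_mk] with t ht ht'
    rwa [← ht']
  filter_upwards [h1, hm.ae_eq_mk] with t ht ht'
  rw [ht']
  have h2 : ‖hm.mk f t‖ₑ * N ≤ ∫⁻ x, G x * ‖φ (t - x)‖ₑ := by
    rw [hN, ← lintegral_sub_left_eq_self _ t, ← lintegral_const_mul _ (by fun_prop)]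
    refine lintegral_mono_ae ?_
    filter_upwards [ht] with x hx
    rw [sq, ← mul_assoc]
    gcongr
  rcases eq_or_ne N ∞ with h | h
  · have := hφ.memLp_two.2
    rw [eLpNorm_lt_top_iff_lintegral_rpow_enorm_lt_top (by norm_num) (by norm_num)] at this
    simp only [ENNReal.toReal_ofNat, ENNReal.rpow_ofNat] at this
    exact absurd h this.ne
  · rw [mul_comm, ← div_eq_mul_inv, ENNReal.le_div_iff_mul_le (Or.inl hN0) (Or.inl h)]
    exact h2

theorem integrable_of_lintegral_stft_lt_top {φ f : V → ℂ} (hφ : IsGelfandShilov φ) (h0 : φ ≠ 0)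
    (hm : AEStronglyMeasurable f)
    (hf : ∀ ψ : V → ℂ, IsGelfandShilov ψ → Integrable (fun x => f x * ψ x))
    (hfin : ∫⁻ x : V, ∫⁻ ω, ‖stft φ f x ω‖ₑ < ∞) : Integrable f := by
  obtain ⟨c, hc, hb⟩ := exists_enorm_le_lintegral_stft hφ h0 hm hf
  refine ⟨hm, (lintegral_mono_ae hb).trans_lt ?_⟩
  have hφm := hφ.continuous.measurable
  rw [lintegral_const_mul' _ _ hc, lintegral_lconv (measurable_lintegral_stft hφ.continuous hm)
    (by fun_prop : Measurable fun y => ‖φ y‖ₑ)]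
  exact ENNReal.mul_lt_top hc.lt_top (ENNReal.mul_lt_top hfin hφ.integrable.2)

/-- After Fubini, `x` occurs only in the window and in the character; the substitution `x ↦ t - x`
separates the two integrals. -/
theorem integral_stft_mul_exp {φ g : V → ℂ} (hφ : Integrable φ) (hc : Continuous φ)
    (hg : Integrable g) (ω ξ : V) :
    ∫ x, stft φ g x ω * Complex.exp ((2 * Real.pi * inner ℝ x ξ : ℝ) * Complex.I) =
      conj (𝓕 φ (-ξ)) * 𝓕 g (ω - ξ) := by
  have hInt : Integrable (fun z : V × V => g z.2 * conj (φ (z.2 - z.1)) *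
      Complex.exp (-(2 * Real.pi * inner ℝ ω z.2 : ℝ) * Complex.I) *
      Complex.exp ((2 * Real.pi * inner ℝ z.1 ξ : ℝ) * Complex.I)) (volume.prod volume) := by
    have hnorm : ∀ z : V × V, ‖g z.2 * conj (φ (z.2 - z.1)) *
      Complex.exp (-(2 * Real.pi * inner ℝ ω z.2 : ℝ) * Complex.I) *
      Complex.exp ((2 * Real.pi * inner ℝ z.1 ξ : ℝ) * Complex.I)‖ = ‖g z.2‖ * ‖φ (z.2 - z.1)‖ := by
      intro z
      rw [norm_mul, norm_mul, norm_mul, Complex.norm_exp_ofReal_mul_I, ← Complex.ofReal_neg,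
        Complex.norm_exp_ofReal_mul_I, RCLike.norm_conj, mul_one, mul_one]
    have hmeas : AEStronglyMeasurable (fun z : V × V => g z.2 * conj (φ (z.2 - z.1)) *
      Complex.exp (-(2 * Real.pi * inner ℝ ω z.2 : ℝ) * Complex.I) *
      Complex.exp ((2 * Real.pi * inner ℝ z.1 ξ : ℝ) * Complex.I)) (volume.prod volume) := by
      refine ((hg.1.comp_snd.mul ?_).mul ?_).mul ?_
      all_goals
        refine Continuous.aestronglyMeasurable ?_
        fun_prop
    refine ⟨hmeas, ?_⟩
    rw [hasFiniteIntegral_iff_enorm]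
    simp_rw [← ofReal_norm, hnorm, ENNReal.ofReal_mul (norm_nonneg _), ofReal_norm]
    rw [lintegral_prod_symm _ (by
      have h1 := hg.1.comp_snd (μ := (volume : Measure V))
      exact (h1.enorm).mul (by fun_prop))]
    have : ∀ t : V, ∫⁻ x, ‖g t‖ₑ * ‖φ (t - x)‖ₑ = ‖g t‖ₑ * ∫⁻ x, ‖φ x‖ₑ := by
      intro t
      have hφm := hc.measurable
      rw [lintegral_const_mul _ (by fun_prop), lintegral_sub_left_eq_self (fun x => ‖φ x‖ₑ) t]
    simp_rw [this]
    rw [lintegral_mul_const' _ _ hφ.2.ne]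
    exact ENNReal.mul_lt_top hg.2 hφ.2
  calc _ = ∫ x, ∫ t, g t * conj (φ (t - x)) *
      Complex.exp (-(2 * Real.pi * inner ℝ ω t : ℝ) * Complex.I) *
      Complex.exp ((2 * Real.pi * inner ℝ x ξ : ℝ) * Complex.I) := by
        refine integral_congr_ae (Filter.Eventually.of_forall fun x => ?_)
        simp only [stft]
        rw [← integral_mul_const]
    _ = ∫ t, ∫ x, g t * conj (φ (t - x)) *
      Complex.exp (-(2 * Real.pi * inner ℝ ω t : ℝ) * Complex.I) *
      Complex.exp ((2 * Real.pi * inner ℝ x ξ : ℝ) * Complex.I) := integral_integral_swap hInt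
    _ = ∫ t, conj (𝓕 φ (-ξ)) *
        (Complex.exp ((-2 * Real.pi * inner ℝ t (ω - ξ) : ℝ) * Complex.I) • g t) := by
        refine integral_congr_ae (Filter.Eventually.of_forall fun t => ?_)
        simp only [smul_eq_mul]
        rw [← integral_sub_left_eq_self _ volume t, Real.fourier_eq', ← integral_conj,
            ← integral_mul_const]
        refine integral_congr_ae (Filter.Eventually.of_forall fun x => ?_)
        simp only [smul_eq_mul, map_mul, sub_sub_cancel, ← Complex.exp_conj, Complex.conj_ofReal,
          Complex.conj_I]
        have : Complex.exp (-(2 * Real.pi * inner ℝ ω t : ℝ) * Complex.I) *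
            Complex.exp ((2 * Real.pi * inner ℝ (t - x) ξ : ℝ) * Complex.I) =
          Complex.exp ((-2 * Real.pi * inner ℝ x (-ξ) : ℝ) * -Complex.I) *
            Complex.exp ((-2 * Real.pi * inner ℝ t (ω - ξ) : ℝ) * Complex.I) := by
          rw [← Complex.exp_add, ← Complex.exp_add]
          congr 1
          rw [inner_sub_left, inner_sub_right, inner_neg_right, real_inner_comm t ω]
          push_cast
          ring
        linear_combination (g t * conj (φ x)) * this
    _ = _ := by rw [integral_const_mul, ← Real.fourier_eq']

/-- The frequency-side counterpart of `ae_enorm_mul_enorm_window_le`: absolute values in the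
preceding identity at `ω = η + ξ`. It holds at every point, and `ξ` remains free to be fixed or
averaged. -/
theorem enorm_fourier_mul_le_lintegral_stft {φ g : V → ℂ} (hφ : IsGelfandShilov φ)
    (hg : Integrable g) (η ξ : V) :
    ‖𝓕 g η‖ₑ * ‖𝓕 φ (-ξ)‖ₑ ≤ ∫⁻ x, ‖stft φ g x (η + ξ)‖ₑ := by
  have h := integral_stft_mul_exp hφ.integrable hφ.continuous hg (η + ξ) ξ
  rw [add_sub_cancel_right] at h
  calc ‖𝓕 g η‖ₑ * ‖𝓕 φ (-ξ)‖ₑ = ‖conj (𝓕 φ (-ξ)) * 𝓕 g η‖ₑ := by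
        rw [enorm_mul, mul_comm]
        congr 1
        rw [← ofReal_norm, ← ofReal_norm, RCLike.norm_conj]
    _ ≤ _ := by
        rw [← h]
        refine (enorm_integral_le_lintegral_enorm _).trans_eq (lintegral_congr fun x => ?_)
        rw [enorm_mul, ← ofReal_norm (Complex.exp _), Complex.norm_exp_ofReal_mul_I]
        simp

/-- The Fourier transform of a function in a frequency-weighted modulation space is a continuous
weighted `L¹ ∩ L^∞` function. -/
theorem MemModulationOne.fourier_weighted {s : ℝ} (hs : 0 ≤ s) {g : V → ℂ}
    (hg : MemModulationOne (polyWeight 0 s) g) :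
    Continuous (𝓕 g) ∧ ∀ e : ℝ≥0∞, 1 ≤ e →
      eLpNorm (fun η => ‖𝓕 g η‖ₑ * ENNReal.ofReal (bracketPow s η)) e < ∞ := by
  obtain ⟨hm, hf, φ, hφ, h0, hi⟩ := hg
  set w : V → ℝ≥0∞ := fun ω => ENNReal.ofReal (bracketPow s ω) with hw
  have hwm : Measurable w := (continuous_bracketPow s).measurable.ennreal_ofReal
  have hw1 : ∀ ω, 1 ≤ w ω := fun ω => by
    rw [hw, ENNReal.one_le_ofReal]; exact one_le_bracketPow hs ω
  have hstm : AEMeasurable (fun z : V × V => ‖stft φ g z.1 z.2‖ₑ) (volume.prod volume) := by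
    simp_rw [stft_congr hm.ae_eq_mk]
    exact (stronglyMeasurable_stft hφ.continuous hm.stronglyMeasurable_mk).enorm.aemeasurable
  have hfin : ∫⁻ ω : V, w ω * ∫⁻ x, ‖stft φ g x ω‖ₑ < ∞ := by
    have h1 := hi.2
    rw [hasFiniteIntegral_iff_enorm, Measure.volume_eq_prod, lintegral_prod_symm _ hi.1.enorm] at h1
    refine lt_of_eq_of_lt (lintegral_congr fun ω => ?_) h1
    rw [← lintegral_const_mul' _ _ ENNReal.ofReal_ne_top]
    refine lintegral_congr fun x => ?_
    rw [enorm_mul]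
    congr 1
    rw [← ofReal_norm, Complex.norm_real, polyWeight, bracketPow_zero, one_mul,
      Real.norm_of_nonneg (bracketPow_pos s ω).le]
  -- Since `s ≥ 0` the weight is at least `1`, so the unweighted STFT is integrable too.
  have hgi : Integrable g := by
    refine integrable_of_lintegral_stft_lt_top hφ h0 hm hf ?_
    rw [lintegral_lintegral_swap hstm]
    refine lt_of_le_of_lt (lintegral_mono fun ω => ?_) hfin
    exact le_mul_of_one_le_left zero_le (hw1 ω)
  have hcont := continuous_fourier hgi
  refine ⟨hcont, fun e he => (eLpNorm_le_eLpNorm_one_add_eLpNorm_top _ he).trans_lt ?_⟩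
  set K : V → ℝ≥0∞ := fun ω => ∫⁻ x, ‖stft φ g x ω‖ₑ with hK
  set M := ∫⁻ ω : V, w ω * K ω with hM
  have hφc : Continuous (𝓕 φ) := continuous_fourier hφ.integrable
  set c : ℝ≥0∞ := ENNReal.ofReal (2 ^ (s / 2)) with hcdef
  have hsub : ∀ η ξ : V, w η ≤ c * (w (η + ξ) * w ξ) := by
    intro η ξ
    have := bracketPow_add_le_of_nonneg hs (η + ξ) (-ξ)
    rw [add_neg_cancel_right, bracketPow_neg_arg] at this
    rw [hw, hcdef, ← ENNReal.ofReal_mul (bracketPow_pos _ _).le,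
        ← ENNReal.ofReal_mul (by positivity)]
    exact ENNReal.ofReal_le_ofReal this
  have hpt : ∀ η ξ : V, ‖𝓕 g η‖ₑ * w η * ‖𝓕 φ (-ξ)‖ₑ ≤ c * w ξ * (w (η + ξ) * K (η + ξ)) := by
    intro η ξ
    calc ‖𝓕 g η‖ₑ * w η * ‖𝓕 φ (-ξ)‖ₑ = w η * (‖𝓕 g η‖ₑ * ‖𝓕 φ (-ξ)‖ₑ) := by ring
      _ ≤ (c * (w (η + ξ) * w ξ)) * K (η + ξ) :=
        mul_le_mul' (hsub η ξ) (enorm_fourier_mul_le_lintegral_stft hφ hgi η ξ)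
      _ = _ := by ring
  -- For the `L¹` bound a single shift with nonvanishing window transform is enough: integrate the
  -- pointwise bound in `η`.
  obtain ⟨ξ', hξ'⟩ := hφ.fourier_ne_zero h0
  refine ENNReal.add_lt_top.2 ⟨?_, ?_⟩
  · rw [eLpNorm_one_eq_lintegral_enorm]
    simp only [enorm_eq_self]
    have h1 : (∫⁻ η, ‖𝓕 g η‖ₑ * w η) * ‖𝓕 φ ξ'‖ₑ ≤ c * w (-ξ') * M := by
      rw [← lintegral_mul_const' _ _ enorm_ne_top]
      calc _ ≤ ∫⁻ η, c * w (-ξ') * (w (η + -ξ') * K (η + -ξ')) :=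
            lintegral_mono fun η => by simpa using hpt η (-ξ')
        _ = _ := by
            rw [lintegral_const_mul' _ _ (ENNReal.mul_ne_top ENNReal.ofReal_ne_top
              ENNReal.ofReal_ne_top), lintegral_add_right_eq_self (fun η => w η * K η)]
    by_contra! h
    rw [top_le_iff] at h
    rw [h, ENNReal.top_mul (by simpa using hξ'), top_le_iff] at h1
    exact (ENNReal.mul_lt_top (ENNReal.mul_lt_top ENNReal.ofReal_lt_top ENNReal.ofReal_lt_top)
      hfin).ne h1
  -- For the sup bound `η` is fixed and the pointwise bound is integrated in `ξ`; the factor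
  -- `⟨ξ⟩^(-s)` cancels the `w ξ` produced by Peetre.
  · set L := ∫⁻ ξ, ‖𝓕 φ (-ξ)‖ₑ * ENNReal.ofReal (bracketPow (-s) ξ) with hL
    have hL0 : L ≠ 0 := by
      intro h
      have hm' := (continuous_bracketPow (V := V) (-s)).measurable
      have hφm := hφc.measurable
      rw [hL, lintegral_eq_zero_iff (by fun_prop)] at h
      have h2 : (fun ξ => 𝓕 φ (-ξ)) = 0 := by
        refine ((hφc.comp continuous_neg).ae_eq_iff_eq volume continuous_zero).1 ?_
        filter_upwards [h] with ξ hξ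
        simpa [not_le.2 (bracketPow_pos (-s) ξ)] using hξ
      exact hξ' (by simpa using congrFun h2 (-ξ'))
    have h1 : ∀ η, ‖𝓕 g η‖ₑ * w η * L ≤ c * M := by
      intro η
      rw [hL, hM, ← lintegral_const_mul' _ _ (ENNReal.mul_ne_top enorm_ne_top
          ENNReal.ofReal_ne_top),
        ← lintegral_add_left_eq_self (fun ω => w ω * K ω) η,
            ← lintegral_const_mul' _ _ ENNReal.ofReal_ne_top]
      refine lintegral_mono fun ξ => ?_
      calc ‖𝓕 g η‖ₑ * w η * (‖𝓕 φ (-ξ)‖ₑ * ENNReal.ofReal (bracketPow (-s) ξ))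
          ≤ c * w ξ * (w (η + ξ) * K (η + ξ)) * ENNReal.ofReal (bracketPow (-s) ξ) := by
            rw [← mul_assoc]
            exact mul_le_mul_left (hpt η ξ) _
        _ = c * (w (η + ξ) * K (η + ξ)) * (w ξ * ENNReal.ofReal (bracketPow (-s) ξ)) := by ring
        _ = _ := by
            rw [show w ξ * ENNReal.ofReal (bracketPow (-s) ξ) = 1 by
              rw [hw, ← ENNReal.ofReal_mul (bracketPow_pos _ _).le, bracketPow_mul_neg,
                ENNReal.ofReal_one], mul_one]
    rw [eLpNorm_exponent_top]
    have hcM : c * M ≠ ∞ := (ENNReal.mul_lt_top ENNReal.ofReal_lt_top hfin).ne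
    have hLtop : L ≠ ∞ → eLpNormEssSup (fun η => ‖𝓕 g η‖ₑ * w η) volume ≤ c * M / L := by
      intro h
      refine essSup_le_of_ae_le _ (Filter.Eventually.of_forall fun η => ?_)
      simp only [enorm_eq_self]
      rw [ENNReal.le_div_iff_mul_le (Or.inl hL0) (Or.inl h)]
      exact h1 η
    -- Finiteness of `L` need not be proved: if `L = ∞`, the bound by `c * M < ∞` forces the left
    -- side to vanish.
    rcases eq_or_ne L ∞ with h | h
    · have h2 : ∀ η, ‖𝓕 g η‖ₑ * w η = 0 := by
        intro η
        by_contra hne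
        have := h1 η
        rw [h, ENNReal.mul_top hne, top_le_iff] at this
        exact hcM this
      have h3 : (fun η => ‖𝓕 g η‖ₑ * w η) = fun _ => 0 := funext h2
      change eLpNormEssSup (fun η => ‖𝓕 g η‖ₑ * w η) volume < ∞
      rw [h3]
      simp [eLpNormEssSup]
    · exact (hLtop h).trans_lt (ENNReal.div_lt_top hcM hL0)

end Modulation

/-! ### Embedding of modulation spaces in mixed-norm spaces -/

section Embedding

variable {d : ℕ}

/-- Only the endpoints matter: for `L¹` Tonelli integrates out the first kernel factor, and for
`L^∞` that factor is at most `1`. -/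
theorem eLpNorm_slice_le_lconv {p : ℝ≥0∞} (hp : 1 ≤ p) {D : Phase d → ℝ≥0∞} (hD : Measurable D)
    {E : Conf d → ℝ≥0∞} (hE : Measurable E) (hE1 : ∀ x, E x ≤ 1) {c : ℝ≥0∞} (hc : c ≠ ∞)
    {f : Conf d → ℂ} {ω : Conf d}
    (h : ∀ᵐ x, ‖f x‖ₑ ≤ c * ∫⁻ y : Phase d, D y * (E (x - y.1) * E (ω - y.2))) :
    eLpNorm f p ≤ (c * (∫⁻ x, E x) + c) * ∫⁻ y : Phase d, D y * E (ω - y.2) := by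
  refine (eLpNorm_le_eLpNorm_one_add_eLpNorm_top _ hp).trans ?_
  rw [add_mul]
  refine add_le_add ?_ ?_
  · rw [eLpNorm_one_eq_lintegral_enorm]
    refine (lintegral_mono_ae h).trans_eq ?_
    have hswap : ∫⁻ x, ∫⁻ y : Phase d, D y * (E (x - y.1) * E (ω - y.2)) =
        ∫⁻ y : Phase d, ∫⁻ x, D y * (E (x - y.1) * E (ω - y.2)) :=
      lintegral_lintegral_swap (by fun_prop)
    rw [lintegral_const_mul' _ _ hc, hswap, mul_assoc,
      ← lintegral_const_mul (∫⁻ x, E x) (by fun_prop)]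
    congr 1
    refine lintegral_congr fun y => ?_
    rw [lintegral_const_mul _ (by fun_prop), lintegral_mul_const _ (by fun_prop),
      lintegral_sub_right_eq_self]
    ring
  · rw [eLpNorm_exponent_top]
    refine essSup_le_of_ae_le _ ?_
    filter_upwards [h] with x hx
    refine hx.trans (mul_le_mul_right (lintegral_mono fun y => mul_le_mul_right ?_ _) c)
    exact mul_le_of_le_one_left zero_le (hE1 _)

theorem eLpNorm_lconv_snd_lt_top {q : ℝ≥0∞} (hq : 1 ≤ q) {D : Phase d → ℝ≥0∞} (hD : Measurable D)
    (hDfin : ∫⁻ y, D y < ∞) {E : Conf d → ℝ≥0∞} (hE : Measurable E) (hE1 : ∀ x, E x ≤ 1)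
    (hEfin : ∫⁻ x, E x < ∞) :
    eLpNorm (fun ω : Conf d => ∫⁻ y : Phase d, D y * E (ω - y.2)) q < ∞ := by
  refine (eLpNorm_le_eLpNorm_one_add_eLpNorm_top _ hq).trans_lt (ENNReal.add_lt_top.2 ⟨?_, ?_⟩)
  · rw [eLpNorm_one_eq_lintegral_enorm]
    simp only [enorm_eq_self]
    calc _ = ∫⁻ y : Phase d, ∫⁻ ω : Conf d, D y * E (ω - y.2) :=
          lintegral_lintegral_swap (by fun_prop)
      _ = ∫⁻ y, D y * ∫⁻ x, E x := by
          refine lintegral_congr fun y => ?_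
          rw [lintegral_const_mul _ (by fun_prop), lintegral_sub_right_eq_self]
      _ = (∫⁻ y, D y) * ∫⁻ x, E x := lintegral_mul_const' _ _ hEfin.ne
      _ < ∞ := ENNReal.mul_lt_top hDfin hEfin
  · rw [eLpNorm_exponent_top]
    refine (essSup_le_of_ae_le (∫⁻ y, D y) (Filter.Eventually.of_forall fun ω => ?_)).trans_lt hDfin
    simp only [enorm_eq_self]
    exact lintegral_mono fun y => mul_le_of_le_one_right zero_le (hE1 _)

/-- A function dominated by the convolution of a finite density with a bounded integrable product
kernel lies in all mixed-norm spaces. -/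
theorem memMixed_of_enorm_le_lconv {p q : ℝ≥0∞} (hp : 1 ≤ p) (hq : 1 ≤ q) {t s : ℝ}
    {F : Phase d → ℂ} (hF : AEStronglyMeasurable F) {D : Phase d → ℝ≥0∞} (hD : Measurable D)
    (hDfin : ∫⁻ y, D y < ∞) {E : Conf d → ℝ≥0∞} (hE : Measurable E) (hE1 : ∀ x, E x ≤ 1)
    (hEfin : ∫⁻ x, E x < ∞) {c : ℝ≥0∞} (hc : c ≠ ∞)
    (h : ∀ᵐ z : Phase d, ‖(polyWeight t s z.1 z.2 : ℂ) * F z‖ₑ ≤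
      c * ∫⁻ y, D y * (E (z.1 - y.1) * E (z.2 - y.2))) :
    MemMixed p q t s F := by
  refine ⟨hF, ?_⟩
  have hC : c * (∫⁻ x, E x) + c ≠ ∞ :=
    (ENNReal.add_lt_top.2 ⟨ENNReal.mul_lt_top hc.lt_top hEfin, hc.lt_top⟩).ne
  have hle : eMixedNorm p q t s F ≤ eLpNorm (fun ω : Conf d => (c * (∫⁻ x, E x) + c) *
      ∫⁻ y : Phase d, D y * E (ω - y.2)) q := by
    refine eLpNorm_mono_enorm_ae ?_
    filter_upwards [ae_ae_swap h] with ω hω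
    rw [enorm_eq_self, enorm_eq_self]
    exact eLpNorm_slice_le_lconv hp hD hE hE1 hc hω
  refine hle.trans_lt ?_
  rw [eLpNorm_const_mul_ennreal hC]
  exact ENNReal.mul_lt_top hC.lt_top (eLpNorm_lconv_snd_lt_top hq hD hDfin hE hE1 hEfin)

theorem norm_fst_add_norm_snd_le (Z : EPhase d) :
    ‖(WithLp.ofLp Z).1‖ + ‖(WithLp.ofLp Z).2‖ ≤ 2 * ‖Z‖ := by
  have h := WithLp.prod_norm_sq_eq_of_L2 Z
  have h' : ‖Z‖ ^ 2 = ‖(WithLp.ofLp Z).1‖ ^ 2 + ‖(WithLp.ofLp Z).2‖ ^ 2 := h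
  have h1 : ‖(WithLp.ofLp Z).1‖ ≤ ‖Z‖ := by
    refine (sq_le_sq₀ (norm_nonneg _) (norm_nonneg _)).1 ?_
    rw [h']
    exact le_add_of_nonneg_right (sq_nonneg _)
  have h2 : ‖(WithLp.ofLp Z).2‖ ≤ ‖Z‖ := by
    refine (sq_le_sq₀ (norm_nonneg _) (norm_nonneg _)).1 ?_
    rw [h']
    exact le_add_of_nonneg_left (sq_nonneg _)
  linarith

theorem exists_norm_mul_polyWeight_le_exp {φ : EPhase d → ℂ} (hφ : IsGelfandShilov φ) (t s : ℝ) :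
    ∃ C : ℝ, 0 ≤ C ∧ ∀ Z : EPhase d,
      ‖φ Z‖ * polyWeight |t| |s| (WithLp.ofLp Z).1 (WithLp.ofLp Z).2 ≤
        C * (Real.exp (-‖(WithLp.ofLp Z).1‖) * Real.exp (-‖(WithLp.ofLp Z).2‖)) := by
  -- As `|x| + |y| ≤ 2‖Z‖`, the rate `4` supplies two copies of `exp (-(|x| + |y|))`: one absorbs
  -- the polynomial weights, the other is the kernel.
  obtain ⟨C, hC, hb⟩ := exists_norm_le_exp_neg (hφ.2 4 (by norm_num)).1
  obtain ⟨C₁, hC₁, hb₁⟩ := exists_bracketPow_le_exp (V := Conf d) |t|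
  obtain ⟨C₂, hC₂, hb₂⟩ := exists_bracketPow_le_exp (V := Conf d) |s|
  refine ⟨C * (C₁ * C₂), by positivity, fun Z => ?_⟩
  have hn := norm_fst_add_norm_snd_le Z
  set x := (WithLp.ofLp Z).1
  set y := (WithLp.ofLp Z).2
  calc _ ≤ (C * Real.exp (-(4 * ‖Z‖))) * ((C₁ * Real.exp ‖x‖) * (C₂ * Real.exp ‖y‖)) := by
        refine mul_le_mul (hb Z) ?_ (mul_pos (bracketPow_pos _ _) (bracketPow_pos _ _)).le
          (by positivity)
        exact mul_le_mul (hb₁ x) (hb₂ y) (bracketPow_pos _ _).le (by positivity)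
    _ = C * (C₁ * C₂) * Real.exp (-(4 * ‖Z‖) + (‖x‖ + ‖y‖)) := by
        rw [Real.exp_add, Real.exp_add]; ring
    _ ≤ _ := by
        rw [← Real.exp_add]
        refine mul_le_mul_of_nonneg_left (Real.exp_le_exp.2 ?_) (by positivity)
        linarith

/-- The function is dominated by `G * |φ|`, `G` being the dual-variable integral of its STFT. By
Peetre the weight `w` splits over this convolution into the finite density `G w` and the kernel `|φ|
w_{|t|,|s|}`, which lies below a product of exponentials. -/
theorem MemModulationOnePhase.memMixed {p q : ℝ≥0∞} (hp : 1 ≤ p) (hq : 1 ≤ q) {t s : ℝ}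
    {F : Phase d → ℂ} (hF : MemModulationOnePhase t s F) : MemMixed p q t s F := by
  obtain ⟨hm, hf, φ, hφ, h0, hi⟩ := hF
  have mp : MeasurePreserving (WithLp.toLp 2 : Phase d → EPhase d) :=
    WithLp.volume_preserving_toLp _ _
  obtain ⟨c, hc, hbound⟩ := exists_enorm_le_lintegral_stft hφ h0 hm hf
  obtain ⟨C, hC, hexp⟩ := exists_norm_mul_polyWeight_le_exp hφ t s
  set G : EPhase d → ℝ≥0∞ := fun Z => ∫⁻ ζ, ‖stft φ (onEPhase F) Z ζ‖ₑ with hG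
  have hGm : Measurable G := measurable_lintegral_stft hφ.continuous hm
  set W : Phase d → ℝ≥0∞ := fun z => ENNReal.ofReal (polyWeight t s z.1 z.2) with hW
  have hWm : Measurable W := by
    refine Measurable.ennreal_ofReal ?_
    exact ((continuous_bracketPow t).comp continuous_fst).measurable.mul
      ((continuous_bracketPow s).comp continuous_snd).measurable
  have hpw : ∀ (a b : ℝ) (x y : Conf d), 0 < polyWeight a b x y := fun a b x y =>
    mul_pos (bracketPow_pos _ _) (bracketPow_pos _ _)
  have hfin : ∫⁻ Z, G Z * W (WithLp.ofLp Z) < ∞ := by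
    have h1 := hi.2
    rw [hasFiniteIntegral_iff_enorm, Measure.volume_eq_prod, lintegral_prod _ hi.1.enorm] at h1
    refine lt_of_eq_of_lt (lintegral_congr fun Z => ?_) h1
    rw [hG, ← lintegral_mul_const' _ _ ENNReal.ofReal_ne_top]
    refine lintegral_congr fun ζ => ?_
    rw [enorm_mul, mul_comm]
    congr 1
    rw [← ofReal_norm, Complex.norm_real, Real.norm_of_nonneg (hpw _ _ _ _).le]
  have hofLp : Measurable (WithLp.ofLp : EPhase d → Phase d) :=
    (WithLp.volume_preserving_ofLp _ _).measurable
  have htoLp := mp.measurable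
  obtain ⟨c', hc', hc'0⟩ : ∃ c' : ℝ, c' = 2 ^ (|t| / 2) * 2 ^ (|s| / 2) ∧ 0 ≤ c' :=
    ⟨_, rfl, by positivity⟩
  have hweight : ∀ z y : Phase d, polyWeight t s z.1 z.2 ≤
      c' * (polyWeight t s y.1 y.2 * polyWeight |t| |s| (z.1 - y.1) (z.2 - y.2)) := by
    intro z y
    have h1 := bracketPow_add_le t y.1 (z.1 - y.1)
    have h2 := bracketPow_add_le s y.2 (z.2 - y.2)
    rw [add_sub_cancel] at h1 h2
    calc _ ≤ _ := mul_le_mul h1 h2 (bracketPow_pos _ _).le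
          ((bracketPow_pos t z.1).le.trans h1)
      _ = _ := by simp only [hc', polyWeight]; ring
  refine memMixed_of_enorm_le_lconv hp hq (D := fun z => G (WithLp.toLp 2 z) * W z)
    (E := fun x => ENNReal.ofReal (Real.exp (-‖x‖))) (c := c * ENNReal.ofReal (c' * C))
    ?_ (by fun_prop) ?_ (by fun_prop) ?_ ?_ (ENNReal.mul_ne_top hc ENNReal.ofReal_ne_top) ?_
  · exact hm.comp_measurePreserving mp
  · exact (mp.lintegral_comp (hGm.mul (hWm.comp hofLp))).trans_lt hfin
  · intro x
    rw [ENNReal.ofReal_le_one]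
    exact Real.exp_le_one_iff.2 (by simp)
  · exact (integrable_exp_neg_norm (V := Conf d) (μ := volume)).lintegral_lt_top
  · filter_upwards [mp.quasiMeasurePreserving.ae hbound] with z hz
    have hφm := hφ.continuous.measurable
    have hz' : ‖F z‖ₑ ≤ c * ∫⁻ y : Phase d, G (WithLp.toLp 2 y) * ‖φ (WithLp.toLp 2 (z - y))‖ₑ := by
      have h1 := mp.lintegral_comp (f := fun Y => G Y * ‖φ (WithLp.toLp 2 z - Y)‖ₑ) (by fun_prop)
      exact hz.trans_eq (congrArg (c * ·) h1.symm)
    calc ‖(polyWeight t s z.1 z.2 : ℂ) * F z‖ₑ = W z * ‖F z‖ₑ := by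
          rw [enorm_mul]
          congr 1
          rw [← ofReal_norm, Complex.norm_real, Real.norm_of_nonneg (hpw _ _ _ _).le]
      _ ≤ W z * (c * ∫⁻ y : Phase d, G (WithLp.toLp 2 y) * ‖φ (WithLp.toLp 2 (z - y))‖ₑ) := by
          gcongr
      _ = c * ∫⁻ y : Phase d, W z * (G (WithLp.toLp 2 y) * ‖φ (WithLp.toLp 2 (z - y))‖ₑ) := by
          rw [lintegral_const_mul' _ _ ENNReal.ofReal_ne_top]; ring
      _ ≤ c * ∫⁻ y : Phase d, ENNReal.ofReal (c' * C) * (G (WithLp.toLp 2 y) * W y *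
          (ENNReal.ofReal (Real.exp (-‖z.1 - y.1‖)) *
            ENNReal.ofReal (Real.exp (-‖z.2 - y.2‖)))) := by
          refine mul_le_mul_right (lintegral_mono fun y => ?_) c
          have key : W z * ‖φ (WithLp.toLp 2 (z - y))‖ₑ ≤ ENNReal.ofReal (c' * C) * (W y *
            (ENNReal.ofReal (Real.exp (-‖z.1 - y.1‖)) *
              ENNReal.ofReal (Real.exp (-‖z.2 - y.2‖)))) := by
            rw [← ofReal_norm, hW, ← ENNReal.ofReal_mul (hpw _ _ _ _).le,
              ← ENNReal.ofReal_mul (Real.exp_pos _).le, ← ENNReal.ofReal_mul (hpw _ _ _ _).le,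
              ← ENNReal.ofReal_mul (by positivity)]
            refine ENNReal.ofReal_le_ofReal ?_
            have h1 := hexp (WithLp.toLp 2 (z - y))
            simp only [Prod.fst_sub, Prod.snd_sub] at h1
            have h2 := (hpw t s y.1 y.2).le
            calc _ ≤ c' * (polyWeight t s y.1 y.2 * polyWeight |t| |s| (z.1 - y.1) (z.2 - y.2)) *
                ‖φ (WithLp.toLp 2 (z - y))‖ := by gcongr; exact hweight z y
              _ = c' * polyWeight t s y.1 y.2 * (‖φ (WithLp.toLp 2 (z - y))‖ *
                polyWeight |t| |s| (z.1 - y.1) (z.2 - y.2)) := by ring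
              _ ≤ c' * polyWeight t s y.1 y.2 * (C * (Real.exp (-‖z.1 - y.1‖) *
                Real.exp (-‖z.2 - y.2‖))) := by gcongr
              _ = _ := by ring
          calc _ = G (WithLp.toLp 2 y) * (W z * ‖φ (WithLp.toLp 2 (z - y))‖ₑ) := by ring
            _ ≤ _ := mul_le_mul_right key _
            _ = _ := by ring
      _ = _ := by rw [lintegral_const_mul' _ _ ENNReal.ofReal_ne_top, mul_assoc]

/-- Test functions lie in `L²`, so Cauchy–Schwarz supplies the required pairings. This reduces `S₀`
to the weighted setting with trivial weight. -/
theorem IsFeichtinger.memModulationOne {V : Type*} [NormedAddCommGroup V] [InnerProductSpace ℝ V]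
    [FiniteDimensional ℝ V] [MeasurableSpace V] [BorelSpace V] {f : V → ℂ} (hf : IsFeichtinger f)
    {w : V → V → ℝ} (hw : ∀ x ω, w x ω = 1) : MemModulationOne w f := by
  obtain ⟨h2, φ, hφ, h0, hi⟩ := hf
  refine ⟨h2.1, fun ψ hψ => h2.integrable_mul hψ.memLp_two, φ, hφ, h0, ?_⟩
  simpa [hw] using hi

end Embedding

/-! ### The norm estimate for the Gabor product -/

section GaborBounds

variable {d : ℕ}

/-- The change of variables `(y, η, ζ) ↦ (y, η, ζ + ω - η)`. -/
def gaborShear (ω : Conf d) (y : Phase d × Conf d) : Conf d × Conf d × Conf d :=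
  (y.1.1, y.1.2, y.2 + ω - y.1.2)

theorem measurePreserving_gaborShear (ω : Conf d) : MeasurePreserving (gaborShear ω) := by
  have h1 : MeasurePreserving (fun y : Phase d × Conf d => (y.1, y.2 + ω - y.1.2))
      ((volume : Measure (Phase d)).prod volume) ((volume : Measure (Phase d)).prod volume) := by
    refine (MeasurePreserving.id (volume : Measure (Phase d))).skew_product
      (g := fun z ζ => ζ + ω - z.2) (by fun_prop) (Filter.Eventually.of_forall fun z => ?_)
    have : (fun ζ : Conf d => ζ + ω - z.2) = fun ζ => ζ + (ω - z.2) := by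
      ext1 ζ; rw [add_sub_assoc]
    rw [this]
    exact (measurePreserving_add_right volume (ω - z.2)).map_eq
  exact (measurePreserving_prodAssoc (volume : Measure (Conf d)) volume volume).comp h1

theorem measurableEmbedding_gaborShear (ω : Conf d) : MeasurableEmbedding (gaborShear ω) := by
  refine Continuous.measurableEmbedding (by unfold gaborShear; fun_prop) ?_
  rintro ⟨⟨a, b⟩, c⟩ ⟨⟨a', b'⟩, c'⟩ h
  simp only [gaborShear, Prod.mk.injEq] at h
  obtain ⟨rfl, rfl, h⟩ := h
  simpa using h

/-- The shear turns `ω' + ω'' - ω` into `ζ`, so the window factor and the phase depend on `ζ` but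
not on `(x', ω')`. -/
theorem gaborIntegrand_gaborShear (g : Conf d → ℂ) (F H : Phase d → ℂ) (x ω : Conf d)
    (y : Phase d × Conf d) :
    gaborIntegrand g F H x ω (gaborShear ω y) =
      conj (𝓕 g y.2) * F y.1 * H (y.1.1, y.2 + ω - y.1.2) *
        Complex.exp ((2 * Real.pi * inner ℝ x y.2 : ℝ) * Complex.I) := by
  simp only [gaborIntegrand, gaborShear]
  rw [show y.1.2 + (y.2 + ω - y.1.2) - ω = y.2 by abel]

theorem integrable_gaborIntegrand {g : Conf d → ℂ} (hg : Continuous (𝓕 g)) {F H : Phase d → ℂ}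
    (hF : Measurable F) (hH : Measurable H) {ω : Conf d}
    (hfin : ∫⁻ ζ : Conf d, ‖𝓕 g ζ‖ₑ *
      ∫⁻ y : Phase d, ‖F y‖ₑ * ‖H (y.1, ζ + ω - y.2)‖ₑ < ∞) (x : Conf d) :
    Integrable (gaborIntegrand g F H x ω) := by
  rw [← (measurePreserving_gaborShear ω).integrable_comp_emb (measurableEmbedding_gaborShear ω)]
  have hgm := hg.measurable
  have hmeas : Measurable (gaborIntegrand g F H x ω ∘ gaborShear ω) := by
    have : gaborIntegrand g F H x ω ∘ gaborShear ω = fun y => _ :=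
      funext fun y => gaborIntegrand_gaborShear g F H x ω y
    rw [this]
    have hconj : Measurable (conj : ℂ → ℂ) := Complex.continuous_conj.measurable
    fun_prop
  refine ⟨hmeas.aestronglyMeasurable, ?_⟩
  rw [hasFiniteIntegral_iff_enorm, Measure.volume_eq_prod,
    lintegral_prod_symm _ hmeas.enorm.aemeasurable]
  refine lt_of_eq_of_lt (lintegral_congr fun ζ => ?_) hfin
  rw [← lintegral_const_mul _ (by fun_prop)]
  refine lintegral_congr fun y => ?_
  rw [Function.comp_apply, gaborIntegrand_gaborShear, ← ofReal_norm, norm_mul, norm_mul, norm_mul,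
    Complex.norm_exp_ofReal_mul_I, RCLike.norm_conj, mul_one, ENNReal.ofReal_mul (by positivity),
    ENNReal.ofReal_mul (by positivity), ofReal_norm, ofReal_norm, ofReal_norm, mul_assoc]

/-- After the shear, Fubini integrates `(x', ω')` first, and the remaining phase `e^{2πi x·ζ}` is
the kernel of the inverse transform. -/
theorem gaborProduct_eq_fourierInv {g : Conf d → ℂ} {F H : Phase d → ℂ} {ω : Conf d}
    (hi : ∀ x, Integrable (gaborIntegrand g F H x ω)) :
    Integrable (fun ζ : Conf d => ∫ y : Phase d, conj (𝓕 g ζ) * F y * H (y.1, ζ + ω - y.2)) ∧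
    ∀ x, gaborProduct g F H (x, ω) =
      𝓕⁻ (fun ζ : Conf d => ∫ y : Phase d, conj (𝓕 g ζ) * F y * H (y.1, ζ + ω - y.2)) x := by
  have hi' : ∀ x, Integrable (fun y : Phase d × Conf d => conj (𝓕 g y.2) * F y.1 *
      H (y.1.1, y.2 + ω - y.1.2) * Complex.exp ((2 * Real.pi * inner ℝ x y.2 : ℝ) * Complex.I))
      (volume.prod volume) := fun x => by
    have := ((measurePreserving_gaborShear ω).integrable_comp_emb
      (measurableEmbedding_gaborShear ω)).2 (hi x)
    exact this.congr (Filter.Eventually.of_forall fun y => gaborIntegrand_gaborShear g F H x ω y)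
  constructor
  -- At `x = 0` the phase is `1`.
  · have := (hi' 0).integral_prod_right
    simpa using this
  · intro x
    rw [gaborProduct, ← (measurePreserving_gaborShear ω).integral_comp
      (measurableEmbedding_gaborShear ω)]
    simp only [gaborIntegrand_gaborShear]
    rw [Measure.volume_eq_prod, integral_prod_symm _ (hi' x), Real.fourierInv_eq']
    refine integral_congr_ae (Filter.Eventually.of_forall fun ζ => ?_)
    simp only [smul_eq_mul]
    rw [integral_mul_const, mul_comm, real_inner_comm]

theorem stronglyMeasurable_gaborProduct {g : Conf d → ℂ} (hg : Continuous (𝓕 g)) {F H : Phase d → ℂ}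
    (hF : Measurable F) (hH : Measurable H) : StronglyMeasurable (gaborProduct g F H) := by
  have hgm := hg.measurable
  have hconj : Measurable (conj : ℂ → ℂ) := Complex.continuous_conj.measurable
  have : Measurable fun y : Phase d × (Conf d × Conf d × Conf d) =>
      gaborIntegrand g F H y.1.1 y.1.2 y.2 := by
    unfold gaborIntegrand
    fun_prop
  exact this.stronglyMeasurable.integral_prod_right'

/-- Hölder's inequality in the position variable. -/
theorem lintegral_slice_mul_le {p p' : ℝ≥0∞} (hp : p⁻¹ + p'⁻¹ = 1) {t₁ t₂ : ℝ} (ht : 0 ≤ t₁ + t₂)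
    (s₁ s₂ : ℝ) {F H : Phase d → ℂ} (hF : Measurable F) (hH : Measurable H) (ω' ω'' : Conf d) :
    ENNReal.ofReal (bracketPow s₁ ω' * bracketPow s₂ ω'') *
        ∫⁻ x, ‖F (x, ω')‖ₑ * ‖H (x, ω'')‖ₑ ≤
      eLpNorm (fun x : Conf d => (polyWeight t₁ s₁ x ω' : ℂ) * F (x, ω')) p *
        eLpNorm (fun x : Conf d => (polyWeight t₂ s₂ x ω'' : ℂ) * H (x, ω'')) p' := by
  have m1 := measurable_slice (measurable_weighted hF t₁ s₁) ω'
  have m2 := measurable_slice (measurable_weighted hH t₂ s₂) ω''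
  have hen : ∀ (f : Conf d → ℂ) (p : ℝ≥0∞), eLpNorm (fun x => ‖f x‖ₑ) p ≤ eLpNorm f p :=
    fun f p => eLpNorm_mono_enorm fun x => by simp
  refine le_trans ?_ (mul_le_mul' (hen _ p) (hen _ p'))
  refine le_trans ?_ (lintegral_mul_le_eLpNorm_mul_eLpNorm hp m1.enorm.aemeasurable
    m2.enorm.aemeasurable)
  rw [← lintegral_const_mul' _ _ ENNReal.ofReal_ne_top]
  refine lintegral_mono fun x => ?_
  -- As `t₁ + t₂ ≥ 0`, the factor `⟨x⟩^{t₁} ⟨x⟩^{t₂} ≥ 1` may be inserted for free.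
  have h1 := one_le_bracketPow ht x
  rw [← bracketPow_mul] at h1
  have p1 := bracketPow_pos s₁ ω'
  have p2 := bracketPow_pos s₂ ω''
  have p3 := bracketPow_pos t₁ x
  have p4 := bracketPow_pos t₂ x
  simp only [← ofReal_norm]
  rw [← ENNReal.ofReal_mul (norm_nonneg _), ← ENNReal.ofReal_mul (by positivity),
    ← ENNReal.ofReal_mul (norm_nonneg _)]
  refine ENNReal.ofReal_le_ofReal ?_
  rw [norm_mul, norm_mul, Complex.norm_real, Complex.norm_real, polyWeight, polyWeight,
    Real.norm_of_nonneg (by positivity), Real.norm_of_nonneg (by positivity)]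
  calc _ ≤ (bracketPow t₁ x * bracketPow t₂ x) *
        (bracketPow s₁ ω' * bracketPow s₂ ω'' * (‖F (x, ω')‖ * ‖H (x, ω'')‖)) :=
        le_mul_of_one_le_left (by positivity) h1
    _ = _ := by ring

/-- Since `ω' + (ζ + ω - ω') = ζ + ω`, the weight at `ω` splits over `ζ` and the two frequencies.
Hölder in `x` for each `ω'` then leaves a convolution of slice norms at `ζ + ω`. -/
theorem weighted_pairing_le {p p' : ℝ≥0∞} (hp : p⁻¹ + p'⁻¹ = 1) {t₁ t₂ s₁ s₂ s C : ℝ}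
    (ht : 0 ≤ t₁ + t₂) (hC : 0 ≤ C)
    (hw : ∀ ω ζ x y : Conf d, x + y = ζ + ω →
      bracketPow s ω ≤ C * (bracketPow |s| ζ * (bracketPow s₁ x * bracketPow s₂ y)))
    {F H : Phase d → ℂ} (hF : Measurable F) (hH : Measurable H) (ω ζ : Conf d) :
    ENNReal.ofReal (bracketPow s ω) * ∫⁻ y : Phase d, ‖F y‖ₑ * ‖H (y.1, ζ + ω - y.2)‖ₑ ≤
      ENNReal.ofReal C * (ENNReal.ofReal (bracketPow |s| ζ) *
        ∫⁻ ω', eLpNorm (fun x : Conf d => (polyWeight t₁ s₁ x ω' : ℂ) * F (x, ω')) p *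
          eLpNorm (fun x : Conf d => (polyWeight t₂ s₂ x (ζ + ω - ω') : ℂ) *
            H (x, ζ + ω - ω')) p') := by
  rw [Measure.volume_eq_prod, lintegral_prod_symm _ (by fun_prop),
    ← lintegral_const_mul' _ _ ENNReal.ofReal_ne_top,
    ← lintegral_const_mul' _ _ ENNReal.ofReal_ne_top,
    ← lintegral_const_mul' _ _ ENNReal.ofReal_ne_top]
  refine lintegral_mono fun ω' => ?_
  have h1 := hw ω ζ ω' (ζ + ω - ω') (by abel)
  have p1 := bracketPow_pos |s| ζ
  have p2 := bracketPow_pos s₁ ω'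
  have p3 := bracketPow_pos s₂ (ζ + ω - ω')
  calc _ ≤ ENNReal.ofReal (C * (bracketPow |s| ζ * (bracketPow s₁ ω' *
        bracketPow s₂ (ζ + ω - ω')))) *
        ∫⁻ x, ‖F (x, ω')‖ₑ * ‖H (x, ζ + ω - ω')‖ₑ :=
        mul_le_mul_left (ENNReal.ofReal_le_ofReal h1) _
    _ = ENNReal.ofReal C * (ENNReal.ofReal (bracketPow |s| ζ) *
        (ENNReal.ofReal (bracketPow s₁ ω' * bracketPow s₂ (ζ + ω - ω')) *
        ∫⁻ x, ‖F (x, ω')‖ₑ * ‖H (x, ζ + ω - ω')‖ₑ)) := by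
        rw [ENNReal.ofReal_mul hC, ENNReal.ofReal_mul p1.le]
        ring
    _ ≤ _ := mul_le_mul_right (mul_le_mul_right
        (lintegral_slice_mul_le hp ht s₁ s₂ hF hH ω' (ζ + ω - ω')) _) _

theorem one_le_of_inv_add_inv {p q : ℝ≥0∞} (h : p⁻¹ + q⁻¹ = 1) : 1 ≤ p := by
  rw [← ENNReal.inv_le_one, ← h]
  exact le_self_add

theorem eLpNorm_fourierInv_eq (u : Conf d → ℂ) (hu : Integrable u) (r : ℝ≥0∞) :
    eLpNorm (𝓕⁻ u) r = eLpNorm (𝓕 u) r := by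
  have : 𝓕⁻ u = 𝓕 u ∘ fun x => -x := funext fun x => Real.fourierInv_eq_fourier_neg u x
  rw [this]
  exact eLpNorm_comp_measurePreserving (continuous_fourier hu).aestronglyMeasurable
    (Measure.measurePreserving_neg volume)

/-- The norm estimate for the Gabor product of measurable functions, with the absolute convergence
of its defining integral. -/
theorem exists_eMixedNorm_gaborProduct_le {p p' q₀ q₀' q₁ q₂ r r' : ℝ≥0∞} (hp : p⁻¹ + p'⁻¹ = 1)
    (hq₀' : q₀⁻¹ + q₀'⁻¹ = 1) (h₁ : 1 ≤ q₁) (h₂ : 1 ≤ q₂) (hq : q₀⁻¹ + 1 = q₁⁻¹ + q₂⁻¹)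
    (hr2 : 2 ≤ r) (hrr' : r⁻¹ + r'⁻¹ = 1) (hr' : r' ≤ q₀) {t₁ t₂ s₁ s₂ s : ℝ}
    (ht : 0 ≤ t₁ + t₂) (hs₁₂ : 0 ≤ s₁ + s₂) (hs : s ≤ min s₁ s₂) {g : Conf d → ℂ}
    (hg : MemModulationOne (polyWeight 0 |s|) g) :
    ∃ C : ℝ≥0∞, C ≠ ∞ ∧ ∀ F H : Phase d → ℂ, Measurable F → Measurable H →
      eMixedNorm p q₁ t₁ s₁ F < ∞ → eMixedNorm p' q₂ t₂ s₂ H < ∞ →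
      (∀ x ω, Integrable (gaborIntegrand g F H x ω)) ∧
      eMixedNorm r q₀ 0 s (gaborProduct g F H) ≤
        C * (eMixedNorm p q₁ t₁ s₁ F * eMixedNorm p' q₂ t₂ s₂ H) := by
  obtain ⟨hgc, hγ⟩ := hg.fourier_weighted (abs_nonneg s)
  obtain ⟨C, hC, hw⟩ := exists_bracketPow_le_mul_mul (V := Conf d) hs₁₂ hs
  obtain ⟨K, hK, hHY⟩ := exists_eLpNorm_fourier_le (V := Conf d) hr2 hrr'
  have h₀ : 1 ≤ q₀ := one_le_of_inv_add_inv hq₀'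
  have h₀' : 1 ≤ q₀' := one_le_of_inv_add_inv (by rwa [add_comm] at hq₀')
  have hr'1 : 1 ≤ r' := one_le_of_inv_add_inv (by rwa [add_comm] at hrr')
  have hr'top : r' ≠ ∞ := by
    rintro rfl
    rw [ENNReal.inv_top, add_zero, ENNReal.inv_eq_one] at hrr'
    rw [hrr'] at hr2
    norm_num at hr2
  obtain ⟨γ, hγdef⟩ : ∃ γ : Conf d → ℝ≥0∞,
    γ = fun η => ‖𝓕 g η‖ₑ * ENNReal.ofReal (bracketPow |s| η) := ⟨_, rfl⟩
  rw [← hγdef] at hγ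
  have hγm : Measurable γ := hγdef ▸
    hgc.measurable.enorm.mul (continuous_bracketPow |s|).measurable.ennreal_ofReal
  have hKC : K * ENNReal.ofReal C ≠ ∞ := ENNReal.mul_ne_top hK ENNReal.ofReal_ne_top
  have hγr : eLpNorm γ r' ≠ ∞ := (hγ r' hr'1).ne
  refine ⟨K * ENNReal.ofReal C * eLpNorm γ r' volume, ENNReal.mul_ne_top hKC hγr, ?_⟩
  intro F H hF hH hFn hHn
  set f : Conf d → ℝ≥0∞ := fun ω =>
    eLpNorm (fun x : Conf d => (polyWeight t₁ s₁ x ω : ℂ) * F (x, ω)) p with hf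
  set h : Conf d → ℝ≥0∞ := fun ω =>
    eLpNorm (fun x : Conf d => (polyWeight t₂ s₂ x ω : ℂ) * H (x, ω)) p' with hh
  have hfm : Measurable f := measurable_inner_eLpNorm (measurable_weighted hF t₁ s₁) p
  have hhm : Measurable h := measurable_inner_eLpNorm (measurable_weighted hH t₂ s₂) p'
  set k : Conf d → ℝ≥0∞ := fun η => ∫⁻ ω, f ω * h (η - ω) with hk
  have hkm : Measurable k := measurable_lconv hfm hhm
  have hkn : eLpNorm k q₀ ≤ eMixedNorm p q₁ t₁ s₁ F * eMixedNorm p' q₂ t₂ s₂ H :=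
    eLpNorm_lconv_le h₀ h₁ h₂ hq hfm hhm
  have hpt : ∀ ω ζ : Conf d, ENNReal.ofReal (bracketPow s ω) *
      (‖𝓕 g ζ‖ₑ * ∫⁻ y : Phase d, ‖F y‖ₑ * ‖H (y.1, ζ + ω - y.2)‖ₑ) ≤
      ENNReal.ofReal C * (γ ζ * k (ζ + ω)) := by
    intro ω ζ
    calc _ = ‖𝓕 g ζ‖ₑ * (ENNReal.ofReal (bracketPow s ω) *
          ∫⁻ y : Phase d, ‖F y‖ₑ * ‖H (y.1, ζ + ω - y.2)‖ₑ) := by ring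
      _ ≤ ‖𝓕 g ζ‖ₑ * (ENNReal.ofReal C * (ENNReal.ofReal (bracketPow |s| ζ) * k (ζ + ω))) :=
          mul_le_mul_right (weighted_pairing_le hp ht hC hw hF hH ω ζ) _
      _ = _ := by rw [hγdef]; ring
  -- Hölder with exponents `q₀'` and `q₀`: the norm of a translate of `k` does not depend on `ω`, so
  -- finiteness holds for every `ω`, not just almost every one.
  have hfin : ∀ ω : Conf d, ∫⁻ ζ : Conf d, ‖𝓕 g ζ‖ₑ *
      ∫⁻ y : Phase d, ‖F y‖ₑ * ‖H (y.1, ζ + ω - y.2)‖ₑ < ∞ := by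
    intro ω
    have h1 : ENNReal.ofReal (bracketPow s ω) * ∫⁻ ζ : Conf d, ‖𝓕 g ζ‖ₑ *
        ∫⁻ y : Phase d, ‖F y‖ₑ * ‖H (y.1, ζ + ω - y.2)‖ₑ < ∞ := by
      rw [← lintegral_const_mul' _ _ ENNReal.ofReal_ne_top]
      refine (lintegral_mono (hpt ω)).trans_lt ?_
      rw [lintegral_const_mul' _ _ ENNReal.ofReal_ne_top]
      refine ENNReal.mul_lt_top ENNReal.ofReal_lt_top ?_
      refine (lintegral_mul_le_eLpNorm_mul_eLpNorm (p := q₀') (q := q₀) (by rwa [add_comm])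
        hγm.aemeasurable (hkm.comp (measurable_add_const ω)).aemeasurable).trans_lt ?_
      have h2 : eLpNorm (k ∘ fun ζ => ζ + ω) q₀ = eLpNorm k q₀ :=
        eLpNorm_comp_measurePreserving hkm.aestronglyMeasurable
            (measurePreserving_add_right volume ω)
      refine ENNReal.mul_lt_top (hγ q₀' h₀') ?_
      exact (h2.trans_le hkn).trans_lt (ENNReal.mul_lt_top hFn hHn)
    by_contra! hcon
    rw [top_le_iff] at hcon
    rw [hcon, ENNReal.mul_top (by simpa using bracketPow_pos s ω)] at h1
    exact lt_irrefl _ h1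
  have hInt : ∀ x ω, Integrable (gaborIntegrand g F H x ω) := fun x ω =>
    integrable_gaborIntegrand hgc hF hH (hfin ω) x
  refine ⟨hInt, ?_⟩
  have hslice : ∀ ω : Conf d,
      eLpNorm (fun x : Conf d => (polyWeight 0 s x ω : ℂ) * gaborProduct g F H (x, ω)) r ≤
        K * ENNReal.ofReal C * eLpNorm (fun ζ => γ ζ * k (ζ + ω)) r' volume := by
    intro ω
    obtain ⟨hu, heq⟩ := gaborProduct_eq_fourierInv (ω := ω) fun x => hInt x ω
    set u : Conf d → ℂ := fun ζ => ∫ y : Phase d, conj (𝓕 g ζ) * F y *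
        H (y.1, ζ + ω - y.2) with hudef
    have hsmul : (fun x : Conf d => (polyWeight 0 s x ω : ℂ) * gaborProduct g F H (x, ω)) =
        (bracketPow s ω : ℂ) • 𝓕⁻ u := by
      ext x
      rw [heq, polyWeight, bracketPow_zero, one_mul]
      rfl
    have hb : ‖(bracketPow s ω : ℂ)‖ₑ = ENNReal.ofReal (bracketPow s ω) := by
      rw [← ofReal_norm, Complex.norm_real, Real.norm_of_nonneg (bracketPow_pos s ω).le]
    rw [hsmul, eLpNorm_const_smul, hb, eLpNorm_fourierInv_eq u hu]
    -- Hausdorff–Young in `ζ`. The weight at `ω` is constant in `x` and in `ζ`, so it passes through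
    -- the transform and is then absorbed by `hpt`.
    calc _ ≤ ENNReal.ofReal (bracketPow s ω) * (K * eLpNorm u r' volume) :=
          mul_le_mul_right (hHY u hu) _
      _ = K * (ENNReal.ofReal (bracketPow s ω) * eLpNorm u r' volume) := by ring
      _ = K * eLpNorm ((bracketPow s ω : ℂ) • u) r' volume := by rw [eLpNorm_const_smul, hb]
      _ ≤ K * eLpNorm (fun ζ => ENNReal.ofReal C * (γ ζ * k (ζ + ω))) r' volume := by
          refine mul_le_mul_right (eLpNorm_mono_enorm fun ζ => ?_) _
          rw [enorm_eq_self, Pi.smul_apply, enorm_smul, hb]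
          refine le_trans (mul_le_mul_right ?_ _) (hpt ω ζ)
          refine (enorm_integral_le_lintegral_enorm _).trans_eq ?_
          rw [← lintegral_const_mul' _ _ enorm_ne_top]
          refine lintegral_congr fun y => ?_
          rw [enorm_mul, enorm_mul, mul_assoc]
          congr 1
          rw [← ofReal_norm, ← ofReal_norm, RCLike.norm_conj]
      _ = _ := by rw [eLpNorm_const_mul_ennreal ENNReal.ofReal_ne_top, mul_assoc]
  have hle : eMixedNorm r q₀ 0 s (gaborProduct g F H) ≤ eLpNorm (fun ω : Conf d =>
      K * ENNReal.ofReal C * eLpNorm (fun ζ => γ ζ * k (ζ + ω)) r' volume) q₀ volume := by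
    refine eLpNorm_mono_enorm fun ω => ?_
    rw [enorm_eq_self, enorm_eq_self]
    exact hslice ω
  refine hle.trans ?_
  calc eLpNorm (fun ω : Conf d => K * ENNReal.ofReal C *
        eLpNorm (fun ζ => γ ζ * k (ζ + ω)) r' volume) q₀ volume
      = K * ENNReal.ofReal C *
          eLpNorm (fun ω => eLpNorm (fun ζ => γ ζ * k (ζ + ω)) r' volume) q₀ volume :=
        eLpNorm_const_mul_ennreal hKC _ _
    -- Minkowski's inequality; this is where `r' ≤ q₀` enters.
    _ ≤ K * ENNReal.ofReal C * (eLpNorm γ r' volume * eLpNorm k q₀ volume) :=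
        mul_le_mul_right (eLpNorm_eLpNorm_mul_translate_le hr'1 hr'top hr' hγm hkm) _
    _ ≤ K * ENNReal.ofReal C * (eLpNorm γ r' volume *
        (eMixedNorm p q₁ t₁ s₁ F * eMixedNorm p' q₂ t₂ s₂ H)) := by gcongr
    _ = _ := by ring

end GaborBounds

/-! ### Passage to equivalence classes and the bilinear extension -/

section Extension

variable {d : ℕ}

/-- Both `(x', ω', ω'') ↦ (x', ω')` and `(x', ω', ω'') ↦ (x', ω'')` pull null sets back to null
sets. Hence the product depends only on the classes of its arguments, at every point. -/
theorem gaborIntegrand_ae_eq {F F' H H' : Phase d → ℂ} (hF : F =ᵐ[volume] F')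
    (hH : H =ᵐ[volume] H') (g : Conf d → ℂ) (x ω : Conf d) :
    gaborIntegrand g F H x ω =ᵐ[volume] gaborIntegrand g F' H' x ω := by
  have q1 : Measure.QuasiMeasurePreserving
      (fun y : Conf d × Conf d × Conf d => ((y.1, y.2.1) : Phase d)) volume volume :=
    (Measure.quasiMeasurePreserving_fst (μ := (volume : Measure (Phase d)))
      (ν := (volume : Measure (Conf d)))).comp
      (measurePreserving_prodAssoc (volume : Measure (Conf d)) volume
        volume).symm.quasiMeasurePreserving
  have q2 : Measure.QuasiMeasurePreserving
      (fun y : Conf d × Conf d × Conf d => ((y.1, y.2.2) : Phase d)) volume volume :=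
    q1.comp ((MeasurePreserving.id (volume : Measure (Conf d))).prod
      (Measure.measurePreserving_swap (μ := (volume : Measure (Conf d)))
        (ν := (volume : Measure (Conf d))))).quasiMeasurePreserving
  filter_upwards [q1.ae hF, q2.ae hH] with y h1 h2
  simp only [gaborIntegrand, h1, h2]

theorem gaborProduct_congr {F F' H H' : Phase d → ℂ} (hF : F =ᵐ[volume] F')
    (hH : H =ᵐ[volume] H') (g : Conf d → ℂ) : gaborProduct g F H = gaborProduct g F' H' :=
  funext fun z => integral_congr_ae (gaborIntegrand_ae_eq hF hH g z.1 z.2)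

theorem gaborProduct_add_left {g : Conf d → ℂ} {F F' H : Phase d → ℂ}
    (h : ∀ x ω, Integrable (gaborIntegrand g F H x ω))
    (h' : ∀ x ω, Integrable (gaborIntegrand g F' H x ω)) :
    gaborProduct g (F + F') H = gaborProduct g F H + gaborProduct g F' H := by
  ext z
  rw [Pi.add_apply, gaborProduct, gaborProduct, gaborProduct, ← integral_add (h _ _) (h' _ _)]
  congr 1
  ext y
  simp only [gaborIntegrand, Pi.add_apply]
  ring

theorem gaborProduct_add_right {g : Conf d → ℂ} {F H H' : Phase d → ℂ}
    (h : ∀ x ω, Integrable (gaborIntegrand g F H x ω))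
    (h' : ∀ x ω, Integrable (gaborIntegrand g F H' x ω)) :
    gaborProduct g F (H + H') = gaborProduct g F H + gaborProduct g F H' := by
  ext z
  rw [Pi.add_apply, gaborProduct, gaborProduct, gaborProduct, ← integral_add (h _ _) (h' _ _)]
  congr 1
  ext y
  simp only [gaborIntegrand, Pi.add_apply]
  ring

theorem gaborProduct_smul_left (g : Conf d → ℂ) (c : ℂ) (F H : Phase d → ℂ) :
    gaborProduct g (c • F) H = c • gaborProduct g F H := by
  ext z
  rw [Pi.smul_apply, smul_eq_mul, gaborProduct, gaborProduct, ← integral_const_mul]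
  congr 1
  ext y
  simp only [gaborIntegrand, Pi.smul_apply, smul_eq_mul]
  ring

theorem gaborProduct_smul_right (g : Conf d → ℂ) (c : ℂ) (F H : Phase d → ℂ) :
    gaborProduct g F (c • H) = c • gaborProduct g F H := by
  ext z
  rw [Pi.smul_apply, smul_eq_mul, gaborProduct, gaborProduct, ← integral_const_mul]
  congr 1
  ext y
  simp only [gaborIntegrand, Pi.smul_apply, smul_eq_mul]
  ring

variable {p q : ℝ≥0∞} [Fact (1 ≤ p)] [Fact (1 ≤ q)] {t s : ℝ}

theorem memMixed_coe (F : MixedLp d p q t s) : MemMixed p q t s (F : Phase d →ₘ[volume] ℂ) :=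
  ⟨F.1.aestronglyMeasurable, F.2⟩

theorem MemMixed.coeFn_toMixedLp {F : Phase d → ℂ} (hF : MemMixed p q t s F) :
    ((hF.toMixedLp : MixedLp d p q t s) : Phase d →ₘ[volume] ℂ) =ᵐ[volume] F :=
  AEEqFun.coeFn_mk F hF.1

theorem MixedLp.ext_ae {F G : MixedLp d p q t s}
    (h : (F : Phase d →ₘ[volume] ℂ) =ᵐ[volume] (G : Phase d →ₘ[volume] ℂ)) : F = G :=
  Subtype.ext (AEEqFun.ext h)

theorem exists_memMixed_gaborProduct {p p' q₀ q₀' q₁ q₂ r : ℝ≥0∞} (hp : p⁻¹ + p'⁻¹ = 1)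
    (hq₀' : q₀⁻¹ + q₀'⁻¹ = 1) (h₁ : 1 ≤ q₁) (h₂ : 1 ≤ q₂) (hR : youngR q₀ q₁ q₂ = 0)
    (hr : max q₀ q₀' ≤ r) {t₁ t₂ s₁ s₂ s : ℝ}
    (ht : 0 ≤ t₁ + t₂) (hs₁₂ : 0 ≤ s₁ + s₂) (hs : s ≤ min s₁ s₂) {g : Conf d → ℂ}
    (hg : MemModulationOne (polyWeight 0 |s|) g) :
    ∃ C : ℝ≥0∞, C ≠ ∞ ∧ ∀ F H : Phase d → ℂ, MemMixed p q₁ t₁ s₁ F → MemMixed p' q₂ t₂ s₂ H →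
      (∀ x ω, Integrable (gaborIntegrand g F H x ω)) ∧
      AEStronglyMeasurable (gaborProduct g F H) ∧
      eMixedNorm r q₀ 0 s (gaborProduct g F H) ≤
        C * (eMixedNorm p q₁ t₁ s₁ F * eMixedNorm p' q₂ t₂ s₂ H) := by
  have h₀ : 1 ≤ q₀ := one_le_of_inv_add_inv hq₀'
  have hinv : ∀ {q : ℝ≥0∞}, 1 ≤ q → q⁻¹ ≠ ∞ := fun h =>
    ENNReal.inv_ne_top.2 (zero_lt_one.trans_le h).ne'
  have hq : q₀⁻¹ + 1 = q₁⁻¹ + q₂⁻¹ := by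
    rw [← ENNReal.toReal_eq_toReal_iff' (ENNReal.add_ne_top.2 ⟨hinv h₀, by simp⟩)
      (ENNReal.add_ne_top.2 ⟨hinv h₁, hinv h₂⟩), ENNReal.toReal_add (hinv h₀) (by simp),
      ENNReal.toReal_add (hinv h₁) (hinv h₂), ENNReal.toReal_one]
    unfold youngR at hR
    linarith
  have hr₀ : r⁻¹ ≤ q₀⁻¹ := ENNReal.inv_le_inv.2 ((le_max_left _ _).trans hr)
  have hr₀' : r⁻¹ ≤ q₀'⁻¹ := ENNReal.inv_le_inv.2 ((le_max_right _ _).trans hr)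
  have hr1 : r⁻¹ ≤ 1 := hr₀.trans (ENNReal.inv_le_one.2 h₀)
  -- Adding the two bounds on `1/r` gives `2/r ≤ 1/q₀ + 1/q₀' = 1`.
  have hr2 : 2 ≤ r := by
    rw [← ENNReal.inv_le_inv, ← ENNReal.mul_le_mul_iff_right (a := 2) (by norm_num) (by norm_num),
      ENNReal.mul_inv_cancel (by norm_num) (by norm_num), two_mul, ← hq₀']
    exact add_le_add hr₀ hr₀'
  obtain ⟨r', hrr'⟩ : ∃ r' : ℝ≥0∞, r⁻¹ + r'⁻¹ = 1 :=
    ⟨(1 - r⁻¹)⁻¹, by rw [inv_inv, add_tsub_cancel_of_le hr1]⟩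
  -- The dual form of `q₀' ≤ r`.
  have hr' : r' ≤ q₀ := by
    rw [← ENNReal.inv_le_inv]
    refine (ENNReal.add_le_add_iff_left (ne_top_of_le_ne_top ENNReal.one_ne_top hr1)).1
      (?_ : r⁻¹ + q₀⁻¹ ≤ r⁻¹ + r'⁻¹)
    rw [hrr', ← hq₀', add_comm]
    gcongr
  obtain ⟨C, hC, hb⟩ := exists_eMixedNorm_gaborProduct_le (d := d) hp hq₀' h₁ h₂ hq hr2 hrr' hr'
    ht hs₁₂ hs hg
  obtain ⟨hgc, -⟩ := hg.fourier_weighted (abs_nonneg s)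
  refine ⟨C, hC, fun F H hF hH => ?_⟩
  obtain ⟨F', mF, eF⟩ := hF.1
  obtain ⟨H', mH, eH⟩ := hH.1
  have nF : eMixedNorm p q₁ t₁ s₁ F' < ∞ := eMixedNorm_congr eF ▸ hF.2
  have nH : eMixedNorm p' q₂ t₂ s₂ H' < ∞ := eMixedNorm_congr eH ▸ hH.2
  obtain ⟨hi, hn⟩ := hb _ _ mF.measurable mH.measurable nF nH
  rw [gaborProduct_congr eF eH, eMixedNorm_congr eF, eMixedNorm_congr eH]
  refine ⟨fun x ω => (hi x ω).congr (gaborIntegrand_ae_eq eF eH g x ω).symm, ?_, hn⟩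
  exact (stronglyMeasurable_gaborProduct hgc mF.measurable mH.measurable).aestronglyMeasurable

/-- The Gabor product as a continuous bilinear map between mixed-norm spaces. -/
theorem exists_gaborProduct_clm {p p' q₀ q₀' q₁ q₂ r : ℝ≥0∞}
    [Fact (1 ≤ p)] [Fact (1 ≤ p')] [Fact (1 ≤ q₀)] [Fact (1 ≤ q₁)] [Fact (1 ≤ q₂)] [Fact (1 ≤ r)]
    (hp : p⁻¹ + p'⁻¹ = 1) (hq₀' : q₀⁻¹ + q₀'⁻¹ = 1) (hR : youngR q₀ q₁ q₂ = 0)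
    (hr : max q₀ q₀' ≤ r) {t₁ t₂ s₁ s₂ s : ℝ}
    (ht : 0 ≤ t₁ + t₂) (hs₁₂ : 0 ≤ s₁ + s₂) (hs : s ≤ min s₁ s₂) {g : Conf d → ℂ}
    (hg : MemModulationOne (polyWeight 0 |s|) g) :
    ∃ B : MixedLp d p q₁ t₁ s₁ →L[ℂ] MixedLp d p' q₂ t₂ s₂ →L[ℂ] MixedLp d r q₀ 0 s,
      (∀ F H : Phase d → ℂ, ∀ (hF : MemMixed p q₁ t₁ s₁ F) (hH : MemMixed p' q₂ t₂ s₂ H),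
        (∀ x ω : Conf d, Integrable (gaborIntegrand g F H x ω)) ∧
          B hF.toMixedLp hH.toMixedLp =ᵐ[volume] gaborProduct g F H) ∧
      ∃ C : ℝ, ∀ F H, ‖B F H‖ ≤ C * ‖F‖ * ‖H‖ := by
  obtain ⟨C, hC, hb⟩ := exists_memMixed_gaborProduct (d := d) hp hq₀' (Fact.out : 1 ≤ q₁)
    (Fact.out : 1 ≤ q₂) hR hr ht hs₁₂ hs hg
  have hmem : ∀ (F : MixedLp d p q₁ t₁ s₁) (H : MixedLp d p' q₂ t₂ s₂),
      MemMixed r q₀ 0 s (gaborProduct g (F : Phase d →ₘ[volume] ℂ) (H : Phase d →ₘ[volume] ℂ)) :=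
    fun F H => ⟨(hb _ _ (memMixed_coe F) (memMixed_coe H)).2.1,
        (hb _ _ (memMixed_coe F) (memMixed_coe H)).2.2.trans_lt
      (ENNReal.mul_lt_top hC.lt_top (ENNReal.mul_lt_top F.2 H.2))⟩
  have hInt := fun (F : MixedLp d p q₁ t₁ s₁) (H : MixedLp d p' q₂ t₂ s₂) =>
    (hb _ _ (memMixed_coe F) (memMixed_coe H)).1
  -- The integral itself defines the map on the whole space, so no density argument is needed.
  -- Absolute convergence at every point makes additivity an identity of functions.
  let B₀ : MixedLp d p q₁ t₁ s₁ →ₗ[ℂ] MixedLp d p' q₂ t₂ s₂ →ₗ[ℂ] MixedLp d r q₀ 0 s :=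
    LinearMap.mk₂ ℂ (fun F H => (hmem F H).toMixedLp)
      (fun F F' H => by
        refine MixedLp.ext_ae ((hmem _ _).coeFn_toMixedLp.trans ?_)
        rw [Submodule.coe_add, Submodule.coe_add,
          gaborProduct_congr (AEEqFun.coeFn_add F.1 F'.1) (ae_eq_refl _),
          gaborProduct_add_left (hInt F H) (hInt F' H)]
        exact ((AEEqFun.coeFn_add _ _).trans
          ((hmem F H).coeFn_toMixedLp.add (hmem F' H).coeFn_toMixedLp)).symm)
      (fun c F H => by
        refine MixedLp.ext_ae ((hmem _ _).coeFn_toMixedLp.trans ?_)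
        rw [Submodule.coe_smul, Submodule.coe_smul,
          gaborProduct_congr (AEEqFun.coeFn_smul c F.1) (ae_eq_refl _), gaborProduct_smul_left]
        exact ((AEEqFun.coeFn_smul _ _).trans
          ((hmem F H).coeFn_toMixedLp.const_smul c)).symm)
      (fun F H H' => by
        refine MixedLp.ext_ae ((hmem _ _).coeFn_toMixedLp.trans ?_)
        rw [Submodule.coe_add, Submodule.coe_add,
          gaborProduct_congr (ae_eq_refl _) (AEEqFun.coeFn_add H.1 H'.1),
          gaborProduct_add_right (hInt F H) (hInt F H')]
        exact ((AEEqFun.coeFn_add _ _).trans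
          ((hmem F H).coeFn_toMixedLp.add (hmem F H').coeFn_toMixedLp)).symm)
      (fun c F H => by
        refine MixedLp.ext_ae ((hmem _ _).coeFn_toMixedLp.trans ?_)
        rw [Submodule.coe_smul, Submodule.coe_smul,
          gaborProduct_congr (ae_eq_refl _) (AEEqFun.coeFn_smul c H.1), gaborProduct_smul_right]
        exact ((AEEqFun.coeFn_smul _ _).trans
          ((hmem F H).coeFn_toMixedLp.const_smul c)).symm)
  have hbound : ∀ F H, ‖B₀ F H‖ ≤ C.toReal * ‖F‖ * ‖H‖ := by
    intro F H
    change ‖(hmem F H).toMixedLp‖ ≤ _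
    rw [norm_mixedLp, norm_mixedLp, norm_mixedLp, eMixedNorm_congr (hmem F H).coeFn_toMixedLp,
      mul_assoc, ← ENNReal.toReal_mul, ← ENNReal.toReal_mul]
    exact ENNReal.toReal_mono (ENNReal.mul_ne_top hC (ENNReal.mul_ne_top F.2.ne H.2.ne))
      (hb _ _ (memMixed_coe F) (memMixed_coe H)).2.2
  refine ⟨B₀.mkContinuous₂ C.toReal hbound, fun F H hF hH => ⟨(hb F H hF hH).1, ?_⟩,
    C.toReal, fun F H => by rw [LinearMap.mkContinuous₂_apply]; exact hbound F H⟩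
  rw [LinearMap.mkContinuous₂_apply]
  refine (hmem hF.toMixedLp hH.toMixedLp).coeFn_toMixedLp.trans ?_
  rw [gaborProduct_congr hF.coeFn_toMixedLp hH.coeFn_toMixedLp]

theorem polyWeight_zero_zero {V : Type*} [NormedAddCommGroup V] (x ω : V) :
    polyWeight 0 0 x ω = 1 := by
  rw [polyWeight, bracketPow_zero, bracketPow_zero, one_mul]

theorem IsFeichtingerPhase.memModulationOnePhase {F : Phase d → ℂ} (hF : IsFeichtingerPhase F) :
    MemModulationOnePhase 0 0 F := by
  unfold IsFeichtingerPhase at hF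
  exact hF.memModulationOne fun Z _ => polyWeight_zero_zero (V := Conf d) _ _

theorem exists_gaborProduct_extension {p p' q₀ q₀' q₁ q₂ r : ℝ≥0∞}
    [Fact (1 ≤ p)] [Fact (1 ≤ p')] [Fact (1 ≤ q₀)] [Fact (1 ≤ q₁)] [Fact (1 ≤ q₂)] [Fact (1 ≤ r)]
    (hp : p⁻¹ + p'⁻¹ = 1) (hq₀' : q₀⁻¹ + q₀'⁻¹ = 1) (hR : youngR q₀ q₁ q₂ = 0)
    (hr : max q₀ q₀' ≤ r) {t₁ t₂ s₁ s₂ s : ℝ}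
    (ht : 0 ≤ t₁ + t₂) (hs₁₂ : 0 ≤ s₁ + s₂) (hs : s ≤ min s₁ s₂) {g : Conf d → ℂ}
    (hg : MemModulationOne (polyWeight 0 |s|) g) :
    ∃ B : MixedLp d p q₁ t₁ s₁ →L[ℂ] MixedLp d p' q₂ t₂ s₂ →L[ℂ] MixedLp d r q₀ 0 s,
      (∀ F H : Phase d → ℂ, MemModulationOnePhase t₁ s₁ F → MemModulationOnePhase t₂ s₂ H →
        ∃ (hF : MemMixed p q₁ t₁ s₁ F) (hH : MemMixed p' q₂ t₂ s₂ H),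
          B hF.toMixedLp hH.toMixedLp =ᵐ[volume] gaborProduct g F H) ∧
      (∀ F H : Phase d → ℂ, ∀ (hF : MemMixed p q₁ t₁ s₁ F) (hH : MemMixed p' q₂ t₂ s₂ H),
        (∀ x ω : Conf d, Integrable (gaborIntegrand g F H x ω)) ∧
          B hF.toMixedLp hH.toMixedLp =ᵐ[volume] gaborProduct g F H) ∧
      ∃ C : ℝ, ∀ F H, ‖B F H‖ ≤ C * ‖F‖ * ‖H‖ :=
  (exists_gaborProduct_clm hp hq₀' hR hr ht hs₁₂ hs hg).imp fun _ hB =>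
    ⟨fun F H hF hH => ⟨hF.memMixed Fact.out Fact.out, hH.memMixed Fact.out Fact.out,
      (hB.1 F H _ _).2⟩, hB⟩

end Extension

end GaborProduct

end

theorem mainTheorem4 (d : ℕ) (p p' q₀ q₀' q₁ q₂ r : ℝ≥0∞)
    [Fact (1 ≤ p)] [Fact (1 ≤ p')] [Fact (1 ≤ q₀)] [Fact (1 ≤ q₁)] [Fact (1 ≤ q₂)] [Fact (1 ≤ r)]
    (hp : p⁻¹ + p'⁻¹ = 1) (hq₀' : q₀⁻¹ + q₀'⁻¹ = 1)
    (hR : youngR q₀ q₁ q₂ = 0) (hr : max q₀ q₀' ≤ r) :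
    (∀ g : Conf d → ℂ, IsFeichtinger g → ¬ g =ᵐ[volume] 0 →
      ∃ B : MixedLp d p q₁ 0 0 →L[ℂ] MixedLp d p' q₂ 0 0 →L[ℂ] MixedLp d r q₀ 0 0,
        -- `B` extends the Gabor product from `S₀ × S₀`
        (∀ F H : Phase d → ℂ, IsFeichtingerPhase F → IsFeichtingerPhase H →
          ∃ (hF : MemMixed p q₁ 0 0 F) (hH : MemMixed p' q₂ 0 0 H),
            B hF.toMixedLp hH.toMixedLp =ᵐ[volume] gaborProduct g F H) ∧
        -- and is given by the same absolutely convergent integral on the whole space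
        (∀ F H : Phase d → ℂ, ∀ (hF : MemMixed p q₁ 0 0 F) (hH : MemMixed p' q₂ 0 0 H),
          (∀ x ω : Conf d, Integrable (gaborIntegrand g F H x ω)) ∧
            B hF.toMixedLp hH.toMixedLp =ᵐ[volume] gaborProduct g F H) ∧
        ∃ C : ℝ, ∀ F H, ‖B F H‖ ≤ C * ‖F‖ * ‖H‖) ∧
    (∀ t₁ t₂ s₁ s₂ s : ℝ, 0 ≤ t₁ + t₂ → 0 ≤ s₁ + s₂ → s ≤ min s₁ s₂ →
      ∀ g : Conf d → ℂ, MemModulationOne (polyWeight 0 |s|) g → ¬ g =ᵐ[volume] 0 →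
      ∃ B : MixedLp d p q₁ t₁ s₁ →L[ℂ] MixedLp d p' q₂ t₂ s₂ →L[ℂ] MixedLp d r q₀ 0 s,
        -- `B` extends the Gabor product from `M^1_{t₁,s₁} × M^1_{t₂,s₂}`
        (∀ F H : Phase d → ℂ, MemModulationOnePhase t₁ s₁ F → MemModulationOnePhase t₂ s₂ H →
          ∃ (hF : MemMixed p q₁ t₁ s₁ F) (hH : MemMixed p' q₂ t₂ s₂ H),
            B hF.toMixedLp hH.toMixedLp =ᵐ[volume] gaborProduct g F H) ∧
        -- and is given by the same absolutely convergent integral on the whole space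
        (∀ F H : Phase d → ℂ, ∀ (hF : MemMixed p q₁ t₁ s₁ F) (hH : MemMixed p' q₂ t₂ s₂ H),
          (∀ x ω : Conf d, Integrable (gaborIntegrand g F H x ω)) ∧
            B hF.toMixedLp hH.toMixedLp =ᵐ[volume] gaborProduct g F H) ∧
        ∃ C : ℝ, ∀ F H, ‖B F H‖ ≤ C * ‖F‖ * ‖H‖) := by
  refine ⟨fun g hg _ => ?_, fun t₁ t₂ s₁ s₂ s ht hs₁₂ hs g hg _ =>
    exists_gaborProduct_extension hp hq₀' hR hr ht hs₁₂ hs hg⟩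
  -- The unweighted statement is the weighted one with all exponents zero.
  have hg' : MemModulationOne (polyWeight 0 |(0 : ℝ)|) g :=
    hg.memModulationOne fun x ω => by rw [abs_zero, polyWeight_zero_zero]
  exact (exists_gaborProduct_extension hp hq₀' hR hr (add_zero 0).ge (add_zero 0).ge
    (min_self 0).ge hg').imp fun _ hB => ⟨fun F H hF hH =>
      hB.1 F H hF.memModulationOnePhase hH.memModulationOnePhase, hB.2⟩
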